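/- Let $\mathbb A$ be a countably infinite set of atoms, let $\mathrm{Sb}$ be the monoid (under composition) of maps $m:\mathbb A\to\mathbb A$ with $m(a)\neq a$ for only finitely many $a$, and let $\mathrm{Perm}\subseteq\mathrm{Sb}$ be the group of bijections in $\mathrm{Sb}$. For $M\in\{\mathrm{Sb},\mathrm{Perm}\}$, an $M$-support of an element $x$ of an $M$-set is a set $C\subseteq\mathbb A$ such that $m_1|_C=m_2|_C$ implies $m_1x=m_2x$ for all $m_1,m_2\in M$. A nominal $M$-set is an $M$-set in which every element $x$ has a finite $M$-support; $\mathrm{supp}(x)$ denotes the least one, and $\dim X=\sup_{x\in X}|\mathrm{supp}(x)|$. Morphisms are the $M$-equivariant maps. Let $U$ be the forgetful functor from nominal $\mathrm{Sb}$-sets to nominal $\mathrm{Perm}$-sets. For nominal $\mathrm{Sb}$-sets $X,Y$, let $X\to_{\mathrm{Sb}}Y$ be their exponent: the set of finitely supported equivariant maps $f:\mathrm{Sb}\times X\to Y$ with action $(m\cdot f)(n,x)=f(nm,x)$. For nominal $\mathrm{Perm}$-sets $X,Y$, elements with disjoint finite supports are called separated, and $X\mathrel{-\!\!*}Y$ (the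 magic wand) is the nominal $\mathrm{Perm}$-set of partial functions $w:X\rightharpoonup Y$ that are finitely supported for the action $(g\cdot w)(x)=g\cdot w(g^{-1}x)$, are defined at $x$ exactly when $w$ and $x$ are separated, and satisfy $\mathrm{supp}(w)=\bigcup_{x\in\mathrm{dom}(w)}\mathrm{supp}(w(x))\setminus\mathrm{supp}(x)$. For equivariant $h:X'\to X$ and $k:Y\to Y'$, the induced map $(X\mathrel{-\!\!*}Y)\to(X'\mathrel{-\!\!*}Y')$ sends $w$ to the unique element of $X'\mathrel{-\!\!*}Y'$ whose value at every $x'$ separated from $w$ is $k(w(h(x')))$. For a nominal $\mathrm{Perm}$-set $Y$, let $[\mathbb A]Y$ be the nominal $\mathrm{Perm}$-set of name abstractions: the quotient of $\mathbb A\times Y$ by the relation $(a,y)\sim(a',y')$ iff $(a\ b)\cdot y=(a'\ b)\cdot y'$ for some atom $b\notin\{a,a'\}\cup\mathrm{supp}(y)\cup\mathrm{supp}(y')$; write $[a]y$ for the class of $(a,y)$. **Statement.** There are isomorphisms of nominal $\mathrm{Perm}$-sets $$e_{X,Y}:\ U(X)\mathrel{-\!\!*}U(Y)\ \cong\ U(X\to_{\mathrm{Sb}}Y),$$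 natural in nominal $\mathrm{Sb}$-sets $X$ with $\dim X\le 1$ and in arbitrary nominal $\mathrm{Sb}$-sets $Y$, such that $e_{X,Y}(w)(\mathrm{id},x)=w(x)$ whenever $w$ is defined at $x$. Moreover, there are isomorphisms of nominal $\mathrm{Perm}$-sets $$\theta_Y:\ [\mathbb A]\,U(Y)\ \cong\ U(\mathbb A\to_{\mathrm{Sb}}Y),$$ natural in the nominal $\mathrm{Sb}$-set $Y$, which arise from $e$ for $X=\mathbb A$: for all $a\in\mathbb A$ and $y\in Y$, the partial function $e_{\mathbb A,Y}^{-1}(\theta_Y([a]y))$ is defined at $a$ with value $y$. -/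

import Mathlib

open CategoryTheory

universe u

namespace NomSets

/-! ### Finite substitutions and finite permutations -/

/-- The monoid `Sb` of finite substitutions: maps `m : 𝔸 → 𝔸` with `m a ≠ a` for only finitely
many `a`. Multiplication is composition. -/
def Sb (𝔸 : Type u) : Submonoid (Function.End 𝔸) where
  carrier := {m | {a : 𝔸 | m a ≠ a}.Finite}
  one_mem' := by
    have : {a : 𝔸 | (1 : Function.End 𝔸) a ≠ a} = ∅ := by
      ext a; simp [Function.End.one_def]
    simp only [Set.mem_ofPred_eq, this, Set.finite_empty]
  mul_mem' := by
    intro m n hm hn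
    refine (hm.union hn).subset ?_
    intro a ha
    by_contra h
    simp only [Set.mem_union, Set.mem_ofPred_eq, not_or, not_not] at h
    apply ha
    change m (n a) = a
    rw [h.2, h.1]

/-- The group `Perm` of finite permutations: the bijections in `Sb`. -/
def FinPerm (𝔸 : Type u) : Subgroup (Equiv.Perm 𝔸) where
  carrier := {g | {a : 𝔸 | g a ≠ a}.Finite}
  one_mem' := by simp
  mul_mem' := by
    intro m n hm hn
    refine (hm.union hn).subset ?_
    intro a ha
    by_contra h
    simp only [Set.mem_union, Set.mem_ofPred_eq, not_or, not_not] at h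
    apply ha
    rw [Equiv.Perm.mul_apply, h.2, h.1]
  inv_mem' := by
    intro g hg
    refine Set.Finite.subset hg ?_
    intro a ha h
    apply ha
    rw [Equiv.Perm.inv_eq_iff_eq, h]

/-- The inclusion of `Perm` into `Sb`. -/
def FinPerm.toSb (𝔸 : Type u) : FinPerm 𝔸 →* Sb 𝔸 where
  toFun g := ⟨fun a => g • a, g.2⟩
  map_one' := rfl
  map_mul' _ _ := rfl

/-- The inclusion identifies finite permutations with the bijective finite substitutions. -/
theorem FinPerm.exists_toSb_eq_iff {𝔸 : Type u} (m : Sb 𝔸) :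
    (∃ g, FinPerm.toSb 𝔸 g = m) ↔ Function.Bijective (fun a : 𝔸 => m • a) := by
  constructor
  · rintro ⟨g, rfl⟩
    exact (g : Equiv.Perm 𝔸).bijective
  · intro h
    exact ⟨⟨Equiv.ofBijective _ h, m.2⟩, rfl⟩

open Classical in
/-- The transposition `(a b)` as a finite permutation. -/
noncomputable def FinPerm.swap {𝔸 : Type u} (a b : 𝔸) : FinPerm 𝔸 :=
  ⟨Equiv.swap a b, (Set.toFinite {a, b}).subset fun c hc => by
    by_contra h
    simp only [Set.mem_insert_iff, Set.mem_singleton_iff, not_or] at h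
    exact hc (Equiv.swap_apply_of_ne_of_ne h.1 h.2)⟩

/-! ### Supports -/

section Support

variable {𝔸 : Type u} (M : Type u) [Monoid M] [MulAction M 𝔸]

/-- `C` is an `M`-support of `x`: elements of `M` that agree on `C` act equally on `x`.
Here `M` is `Sb` or `Perm` with its tautological action on the atoms. -/
def Supports {X : Type u} [MulAction M X] (C : Set 𝔸) (x : X) : Prop :=
  ∀ m₁ m₂ : M, (∀ a ∈ C, m₁ • a = m₂ • a) → m₁ • x = m₂ • x

variable (𝔸) in
/-- The least finite `M`-support of `x`, as the intersection of all finite `M`-supports. -/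
def supp {X : Type u} [MulAction M X] (x : X) : Set 𝔸 :=
  {a | ∀ C : Finset 𝔸, Supports M (C : Set 𝔸) x → a ∈ C}

variable (𝔸) in
/-- Being finitely supported. -/
def FinSupp {X : Type u} [MulAction M X] (x : X) : Prop :=
  ∃ C : Finset 𝔸, Supports M (C : Set 𝔸) x

variable (𝔸) in
/-- Nominal `M`-sets: `M`-sets in which every element has a finite `M`-support. -/
structure Nom where
  carrier : Type u
  [act : MulAction M carrier]
  finSupp : ∀ x : carrier, FinSupp 𝔸 M x

attribute [instance] Nom.act

/-- Nominal `M`-sets with `M`-equivariant maps form a category. -/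
instance : Category (Nom 𝔸 M) where
  Hom X Y := X.carrier →[M] Y.carrier
  id X := MulActionHom.id M
  comp f g := MulActionHom.comp g f

variable {M}

/-- The function underlying a morphism of nominal `M`-sets. -/
def Nom.ap {X Y : Nom 𝔸 M} (f : X ⟶ Y) (x : X.carrier) : Y.carrier :=
  (show X.carrier →[M] Y.carrier from f) x

/-- Morphisms of nominal `M`-sets from equivariant functions. -/
def Nom.mkHom {X Y : Nom 𝔸 M} (f : X.carrier → Y.carrier)
    (hf : ∀ (m : M) x, f (m • x) = m • f x) : X ⟶ Y :=
  (show X.carrier →[M] Y.carrier from ⟨f, hf⟩)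

@[simp] theorem Nom.ap_mkHom {X Y : Nom 𝔸 M} (f : X.carrier → Y.carrier) (hf) (x : X.carrier) :
    Nom.ap (X := X) (Y := Y) (Nom.mkHom f hf) x = f x := rfl

@[simp] theorem Nom.ap_id {X : Nom 𝔸 M} (x : X.carrier) : Nom.ap (𝟙 X) x = x := rfl

@[simp] theorem Nom.ap_comp {X Y Z : Nom 𝔸 M} (f : X ⟶ Y) (g : Y ⟶ Z) (x : X.carrier) :
    Nom.ap (f ≫ g) x = Nom.ap g (Nom.ap f x) := rfl

theorem Nom.ap_smul {X Y : Nom 𝔸 M} (f : X ⟶ Y) (m : M) (x : X.carrier) :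
    Nom.ap f (m • x) = m • Nom.ap f x :=
  map_smul (show X.carrier →[M] Y.carrier from f) m x

theorem Nom.hom_ext {X Y : Nom 𝔸 M} {f g : X ⟶ Y} (h : ∀ x, Nom.ap f x = Nom.ap g x) : f = g :=
  MulActionHom.ext (f := (show X.carrier →[M] Y.carrier from f)) h

/-- The dimension of a nominal `M`-set: the supremum of the cardinalities of least supports. -/
noncomputable def Nom.dim (X : Nom 𝔸 M) : ℕ∞ :=
  ⨆ x : X.carrier, (supp 𝔸 M x).encard

theorem Supports.map {X Y : Nom 𝔸 M} (f : X ⟶ Y) {C : Set 𝔸} {x : X.carrier}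
    (h : Supports M C x) : Supports M C (Nom.ap f x) := by
  intro m₁ m₂ hm
  rw [← Nom.ap_smul, ← Nom.ap_smul, h m₁ m₂ hm]

theorem Supports.mono {X : Type u} [MulAction M X] {C D : Set 𝔸} {x : X}
    (h : Supports M C x) (hCD : C ⊆ D) : Supports M D x :=
  fun m₁ m₂ hm => h m₁ m₂ fun a ha => hm a (hCD ha)

theorem Supports.smul {X : Type u} [MulAction M X] {C : Set 𝔸} {x : X}
    (h : Supports M C x) (m : M) : Supports M ((fun a => m • a) '' C) (m • x) := by
  intro m₁ m₂ hm
  rw [smul_smul, smul_smul]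
  refine h _ _ fun a ha => ?_
  rw [mul_smul, mul_smul]
  exact hm _ ⟨a, ha, rfl⟩

open Classical in
theorem FinSupp.smul {X : Type u} [MulAction M X] {x : X}
    (h : FinSupp 𝔸 M x) (m : M) : FinSupp 𝔸 M (m • x) := by
  obtain ⟨C, hC⟩ := h
  refine ⟨C.image (fun a => m • a), ?_⟩
  rw [Finset.coe_image]
  exact hC.smul m

variable (𝔸 M) in
/-- The nominal `M`-set of atoms. -/
def atoms : Nom 𝔸 M where
  carrier := 𝔸
  finSupp a := ⟨{a}, fun _ _ h => h a (by simp)⟩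

theorem dim_atoms_le : (atoms 𝔸 M).dim ≤ 1 := by
  refine iSup_le fun a => ?_
  have h : ∀ a : 𝔸, supp 𝔸 M (X := (atoms 𝔸 M).carrier) a ⊆ ({a} : Set 𝔸) := by
    intro a b hb
    have h1 := hb {a} (fun _ _ h => h a (by simp))
    exact Finset.mem_singleton.1 h1
  have h2 : ∀ a : 𝔸, (supp 𝔸 M (X := (atoms 𝔸 M).carrier) a).encard ≤ 1 := fun a =>
    (Set.encard_le_encard (h a)).trans (by simp)
  exact h2 a

end Support

/-! ### Exponents of nominal `M`-sets -/

section Exponent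

variable {𝔸 : Type u} {M : Type u} [Monoid M] [MulAction M 𝔸]

variable (M) in
/-- The exponent of `M`-sets: equivariant maps `f : M × X → Y`, where `M` acts on itself by left
multiplication and on the product pointwise. -/
@[ext] structure Expo (X Y : Type u) [MulAction M X] [MulAction M Y] where
  toFun : M × X → Y
  equivariant : ∀ (m : M) (p : M × X), toFun (m • p) = m • toFun p

/-- The action on the exponent, `(m · f)(n, x) = f(n m, x)`. -/
instance {X Y : Type u} [MulAction M X] [MulAction M Y] : MulAction M (Expo M X Y) where
  smul m f := ⟨fun p => f.toFun (p.1 * m, p.2), fun k p => by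
    rw [← f.equivariant]
    simp [Prod.smul_def, mul_assoc]⟩
  one_smul f := by
    apply Expo.ext
    funext p
    change f.toFun (p.1 * 1, p.2) = f.toFun p
    rw [mul_one]
  mul_smul m n f := by
    apply Expo.ext
    funext p
    change f.toFun (p.1 * (m * n), p.2) = f.toFun (p.1 * m * n, p.2)
    rw [mul_assoc]

theorem Expo.smul_apply {X Y : Type u} [MulAction M X] [MulAction M Y] (m : M) (f : Expo M X Y)
    (p : M × X) : (m • f).toFun p = f.toFun (p.1 * m, p.2) := rfl

/-- The finitely supported elements of the exponent of `M`-sets. -/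
@[ext] structure NomExpo (X Y : Nom 𝔸 M) extends Expo M X.carrier Y.carrier where
  finSupp : FinSupp 𝔸 M toExpo

instance (X Y : Nom 𝔸 M) : MulAction M (NomExpo X Y) where
  smul m f := ⟨m • f.toExpo, f.finSupp.smul m⟩
  one_smul f := NomExpo.ext (congrArg Expo.toFun (one_smul M f.toExpo))
  mul_smul m n f := NomExpo.ext (congrArg Expo.toFun (mul_smul m n f.toExpo))

/-- The exponent of nominal `M`-sets. -/
def expObj (X Y : Nom 𝔸 M) : Nom 𝔸 M where
  carrier := NomExpo X Y
  finSupp f := by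
    obtain ⟨C, hC⟩ := f.finSupp
    exact ⟨C, fun m₁ m₂ h => NomExpo.ext (congrArg Expo.toFun (hC m₁ m₂ h))⟩

/-- Functorial action of the exponent: `f ↦ k ∘ f ∘ (id × h)`. -/
def expMap {X X' Y Y' : Nom 𝔸 M} (h : X' ⟶ X) (k : Y ⟶ Y') : expObj X Y ⟶ expObj X' Y' :=
  Nom.mkHom (X := expObj X Y) (Y := expObj X' Y')
    (fun f : NomExpo X Y =>
      { toFun := fun p => Nom.ap k (f.toFun (p.1, Nom.ap h p.2))
        equivariant := fun m p => by
          rw [← Nom.ap_smul, ← f.equivariant]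
          simp [Prod.smul_def, Nom.ap_smul]
        finSupp := by
          obtain ⟨C, hC⟩ := f.finSupp
          refine ⟨C, fun m₁ m₂ hm => ?_⟩
          apply Expo.ext
          funext p
          have := congrArg (fun q : Expo M X.carrier Y.carrier => q.toFun (p.1, Nom.ap h p.2))
            (hC m₁ m₂ hm)
          exact congrArg (Nom.ap k) this })
    (fun _ _ => rfl)

/-- The exponent as a functor, contravariant in the first argument. -/
def expFunctor : (Nom 𝔸 M)ᵒᵖ ⥤ Nom 𝔸 M ⥤ Nom 𝔸 M where
  obj X :=
    { obj := fun Y => expObj X.unop Y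
      map := fun k => expMap (𝟙 X.unop) k }
  map h := { app := fun Y => expMap h.unop (𝟙 Y) }

end Exponent

/-! ### The forgetful functor from nominal `Sb`-sets to nominal `Perm`-sets -/

/-- The category of nominal `Sb`-sets. -/
abbrev SbNom (𝔸 : Type u) := Nom 𝔸 (Sb 𝔸)

/-- The category of nominal `Perm`-sets. -/
abbrev PermNom (𝔸 : Type u) := Nom 𝔸 (FinPerm 𝔸)

/-- A nominal `Sb`-set as a nominal `Perm`-set, restricting the action along `Perm → Sb`. -/
def forgetObj {𝔸 : Type u} (X : SbNom 𝔸) : PermNom 𝔸 where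
  carrier := X.carrier
  act := MulAction.compHom X.carrier (FinPerm.toSb 𝔸)
  finSupp x := by
    obtain ⟨C, hC⟩ := X.finSupp x
    exact ⟨C, fun g₁ g₂ h => hC (FinPerm.toSb 𝔸 g₁) (FinPerm.toSb 𝔸 g₂) h⟩

/-- The forgetful functor `U`. -/
def forgetSb (𝔸 : Type u) : SbNom 𝔸 ⥤ PermNom 𝔸 where
  obj X := forgetObj X
  map {X Y} f := Nom.mkHom (X := forgetObj X) (Y := forgetObj Y)
    (fun x => Nom.ap (X := X) (Y := Y) f x)
    (fun g x => Nom.ap_smul (X := X) (Y := Y) f (FinPerm.toSb 𝔸 g) x)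
  map_id _ := rfl
  map_comp _ _ := rfl

/-! ### Basic facts on supports for finite permutations -/

section PermFacts

variable {𝔸 : Type u}

theorem supports_iff {X : Type u} [MulAction (FinPerm 𝔸) X] {C : Set 𝔸} {x : X} :
    Supports (FinPerm 𝔸) C x ↔ ∀ g : FinPerm 𝔸, (∀ a ∈ C, g • a = a) → g • x = x := by
  constructor
  · intro h g hg
    have := h g 1 (fun a ha => by rw [hg a ha, one_smul])
    rwa [one_smul] at this
  · intro h g₁ g₂ hg
    have := h (g₂⁻¹ * g₁) (fun a ha => by rw [mul_smul, hg a ha, inv_smul_smul])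
    rwa [mul_smul, inv_smul_eq_iff] at this

open Classical in
theorem exists_perm_extend (C : Finset 𝔸) (f : 𝔸 → 𝔸) (hf : Set.InjOn f C) :
    ∃ g : FinPerm 𝔸, ∀ a ∈ C, g • a = f a := by
  let D : Finset 𝔸 := C ∪ C.image f
  let φ : {x : D // (x : 𝔸) ∈ C} → {x : D // (x : 𝔸) ∈ C.image f} := fun x =>
    ⟨⟨f x.1.1, Finset.mem_union_right _ (Finset.mem_image_of_mem f x.2)⟩,
      Finset.mem_image_of_mem f x.2⟩
  have hφ : Function.Bijective φ := by
    constructor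
    · intro x y hxy
      have h1 : f x.1.1 = f y.1.1 := congrArg (fun z => (z.1 : 𝔸)) hxy
      exact Subtype.ext (Subtype.ext (hf x.2 y.2 h1))
    · rintro ⟨⟨y, hy⟩, hy'⟩
      obtain ⟨x, hx, hxy⟩ := Finset.mem_image.1 hy'
      refine ⟨⟨⟨x, Finset.mem_union_left _ hx⟩, hx⟩, ?_⟩
      exact Subtype.ext (Subtype.ext hxy)
  let e := Equiv.ofBijective φ hφ
  let p : Equiv.Perm D := e.extendSubtype
  refine ⟨⟨Equiv.Perm.ofSubtype p, ?_⟩, ?_⟩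
  · refine (D.finite_toSet).subset fun a ha => ?_
    by_contra h
    exact ha (Equiv.Perm.ofSubtype_apply_of_not_mem p h)
  · intro a ha
    have haD : a ∈ D := Finset.mem_union_left _ ha
    change Equiv.Perm.ofSubtype p a = f a
    have h1 := Equiv.Perm.ofSubtype_apply_coe p ⟨a, haD⟩
    refine h1.trans ?_
    have := e.extendSubtype_apply_of_mem ⟨a, haD⟩ ha
    exact congrArg Subtype.val this

open Classical in
theorem exists_perm_fresh [Infinite 𝔸] (A B F : Finset 𝔸) :
    ∃ g : FinPerm 𝔸, (∀ a ∈ A, g • a = a) ∧ ∀ b ∈ B, b ∉ A → g • b ∉ F := by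
  obtain ⟨B', hB', hcard⟩ := Set.Infinite.exists_subset_card_eq
    (s := ((A ∪ F : Finset 𝔸) : Set 𝔸)ᶜ) (Finset.finite_toSet _).infinite_compl B.card
  let e := Finset.equivOfCardEq hcard.symm
  let f : 𝔸 → 𝔸 := fun a => if a ∈ A then a else if h : a ∈ B then (e ⟨a, h⟩ : 𝔸) else a
  have hfB : ∀ b (hb : b ∈ B), b ∉ A → f b = e ⟨b, hb⟩ := by
    intro b hb hbA
    simp [f, hbA, hb]
  have hfA : ∀ a ∈ A, f a = a := by
    intro a ha
    simp [f, ha]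
  have heB : ∀ b, ((e b : 𝔸) ∉ A) ∧ (e b : 𝔸) ∉ F := by
    intro b
    have := hB' (e b).2
    simpa [not_or] using this
  have hinj : Set.InjOn f ((A ∪ B : Finset 𝔸) : Set 𝔸) := by
    intro x hx y hy hxy
    simp only [Finset.coe_union, Set.mem_union, Finset.mem_coe] at hx hy
    by_cases hxA : x ∈ A <;> by_cases hyA : y ∈ A
    · rwa [hfA x hxA, hfA y hyA] at hxy
    · have hyB := hy.resolve_left hyA
      rw [hfA x hxA, hfB y hyB hyA] at hxy
      exact absurd (hxy ▸ hxA) (heB _).1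
    · have hxB := hx.resolve_left hxA
      rw [hfA y hyA, hfB x hxB hxA] at hxy
      exact absurd (hxy.symm ▸ hyA) (heB _).1
    · have hyB := hy.resolve_left hyA
      have hxB := hx.resolve_left hxA
      rw [hfB x hxB hxA, hfB y hyB hyA] at hxy
      have := e.injective (Subtype.ext hxy)
      exact congrArg Subtype.val this
  obtain ⟨g, hg⟩ := exists_perm_extend (A ∪ B) f hinj
  refine ⟨g, fun a ha => ?_, fun b hb hbA => ?_⟩
  · rw [hg a (Finset.mem_union_left _ ha), hfA a ha]
  · rw [hg b (Finset.mem_union_right _ hb), hfB b hb hbA]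
    exact (heB _).2

theorem supp_subset {X : Type u} [MulAction (FinPerm 𝔸) X] {x : X} {C : Finset 𝔸}
    (h : Supports (FinPerm 𝔸) (C : Set 𝔸) x) : supp 𝔸 (FinPerm 𝔸) x ⊆ C := fun _ ha => ha C h

variable [Infinite 𝔸] {X : Type u} [MulAction (FinPerm 𝔸) X]

open Classical in
theorem Supports.inter {C D : Finset 𝔸} {x : X} (hC : Supports (FinPerm 𝔸) (C : Set 𝔸) x)
    (hD : Supports (FinPerm 𝔸) (D : Set 𝔸) x) :
    Supports (FinPerm 𝔸) ((C ∩ D : Finset 𝔸) : Set 𝔸) x := by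
  rw [supports_iff] at hC hD ⊢
  intro g hg
  obtain ⟨h, hh1, hh2⟩ := exists_perm_fresh C D (Set.Finite.toFinset g.2)
  have hx : h • x = x := hC h hh1
  have key : (h⁻¹ * g * h) • x = x := by
    apply hD
    intro a ha
    rw [mul_smul, mul_smul, inv_smul_eq_iff]
    by_cases haC : a ∈ C
    · rw [hh1 a haC]
      exact hg a (by simpa using ⟨haC, ha⟩)
    · have := hh2 a ha haC
      by_contra hne
      exact this ((Set.Finite.mem_toFinset g.2).2 hne)
  rw [mul_smul, mul_smul, hx, inv_smul_eq_iff, hx] at key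
  exact key

/-- A finitely supported element has a least finite support. -/
theorem FinSupp.exists_supp {x : X} (h : FinSupp 𝔸 (FinPerm 𝔸) x) :
    ∃ S : Finset 𝔸, (S : Set 𝔸) = supp 𝔸 (FinPerm 𝔸) x ∧
      Supports (FinPerm 𝔸) (S : Set 𝔸) x := by
  classical
  have hex : ∃ n, ∃ C : Finset 𝔸, C.card = n ∧ Supports (FinPerm 𝔸) (C : Set 𝔸) x := by
    obtain ⟨C, hC⟩ := h
    exact ⟨_, C, rfl, hC⟩
  obtain ⟨S, hS, hSx⟩ := Nat.find_spec hex
  refine ⟨S, Set.Subset.antisymm ?_ (fun a ha => ha S hSx), hSx⟩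
  intro a ha C hC
  have h1 := Supports.inter hSx hC
  have h2 := Nat.find_min' hex ⟨_, rfl, h1⟩
  rw [← hS] at h2
  have h3 := Finset.eq_of_subset_of_card_le Finset.inter_subset_left h2
  have : a ∈ S ∩ C := by rw [h3]; exact ha
  exact (Finset.mem_inter.1 this).2

theorem FinSupp.supports_supp {x : X} (h : FinSupp 𝔸 (FinPerm 𝔸) x) :
    Supports (FinPerm 𝔸) (supp 𝔸 (FinPerm 𝔸) x) x := by
  obtain ⟨S, h1, h2⟩ := h.exists_supp
  rwa [← h1]

theorem supp_finite {x : X} (h : FinSupp 𝔸 (FinPerm 𝔸) x) :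
    (supp 𝔸 (FinPerm 𝔸) x).Finite := by
  obtain ⟨S, h1, -⟩ := h.exists_supp
  rw [← h1]
  exact S.finite_toSet

theorem smul_eq_of_supp {x : X} (h : FinSupp 𝔸 (FinPerm 𝔸) x) {g : FinPerm 𝔸}
    (hg : ∀ a ∈ supp 𝔸 (FinPerm 𝔸) x, g • a = a) : g • x = x :=
  supports_iff.1 h.supports_supp g hg

end PermFacts

section PermFacts2

variable {𝔸 : Type u} {X Y : Type u} [MulAction (FinPerm 𝔸) X] [MulAction (FinPerm 𝔸) Y]

open Classical in
theorem mem_supp_smul_of_mem {x : X} {a : 𝔸} (g : FinPerm 𝔸) (ha : a ∈ supp 𝔸 (FinPerm 𝔸) x) :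
    g • a ∈ supp 𝔸 (FinPerm 𝔸) (g • x) := by
  intro C hC
  have h := hC.smul g⁻¹
  rw [inv_smul_smul] at h
  have h2 := ha (C.image fun a => g⁻¹ • a) (by rwa [Finset.coe_image])
  obtain ⟨c, hc, hca⟩ := Finset.mem_image.1 h2
  rw [inv_smul_eq_iff] at hca
  rwa [← hca]

/-- Least supports are equivariant. -/
theorem smul_mem_supp_smul {x : X} {a : 𝔸} (g : FinPerm 𝔸) :
    g • a ∈ supp 𝔸 (FinPerm 𝔸) (g • x) ↔ a ∈ supp 𝔸 (FinPerm 𝔸) x := by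
  refine ⟨fun h => ?_, mem_supp_smul_of_mem g⟩
  simpa using mem_supp_smul_of_mem g⁻¹ h

theorem mem_supp_smul {x : X} {a : 𝔸} (g : FinPerm 𝔸) :
    a ∈ supp 𝔸 (FinPerm 𝔸) (g • x) ↔ g⁻¹ • a ∈ supp 𝔸 (FinPerm 𝔸) x := by
  rw [← smul_mem_supp_smul (x := x) g, smul_inv_smul]

/-! ### Separation and the magic wand -/

variable (𝔸) in
/-- Two elements are separated if they have disjoint finite supports. -/
def Separated (x : X) (y : Y) : Prop :=
  ∃ C₁ C₂ : Finset 𝔸, Disjoint C₁ C₂ ∧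
    Supports (FinPerm 𝔸) (C₁ : Set 𝔸) x ∧ Supports (FinPerm 𝔸) (C₂ : Set 𝔸) y

theorem separated_iff [Infinite 𝔸] {x : X} {y : Y} (hx : FinSupp 𝔸 (FinPerm 𝔸) x)
    (hy : FinSupp 𝔸 (FinPerm 𝔸) y) :
    Separated 𝔸 x y ↔ ∀ a ∈ supp 𝔸 (FinPerm 𝔸) x, a ∉ supp 𝔸 (FinPerm 𝔸) y := by
  constructor
  · rintro ⟨C, D, hCD, hC, hD⟩ a ha hb
    exact Finset.disjoint_left.1 hCD (ha C hC) (hb D hD)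
  · intro h
    obtain ⟨S, hS, hS'⟩ := hx.exists_supp
    obtain ⟨T, hT, hT'⟩ := hy.exists_supp
    refine ⟨S, T, Finset.disjoint_left.2 fun a ha hb => ?_, hS', hT'⟩
    refine h a ?_ ?_
    · rw [← hS]; exact ha
    · rw [← hT]; exact hb

/-- The conjugation action of a group on partial functions, `(g · f)(x) = g · f(g⁻¹ · x)`,
defined iff `f(g⁻¹ · x)` is. -/
instance pfunAction {G : Type u} [Group G] [MulAction G X] [MulAction G Y] :
    MulAction G (X →. Y) where
  smul g f := fun x => (f (g⁻¹ • x)).map (fun y => g • y)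
  one_smul f := by
    funext x
    change (f ((1 : G)⁻¹ • x)).map (fun y => (1 : G) • y) = f x
    simp [Part.map_id']
  mul_smul g h f := by
    funext x
    change (f ((g * h)⁻¹ • x)).map (fun y => (g * h) • y) =
      ((f (h⁻¹ • g⁻¹ • x)).map (fun y => h • y)).map (fun y => g • y)
    rw [Part.map_map, mul_inv_rev, mul_smul]
    congr 1
    funext y
    exact mul_smul g h y

theorem mem_smul_pfun {g : FinPerm 𝔸} {f : X →. Y} {x : X} {y : Y} :
    y ∈ (g • f) x ↔ g⁻¹ • y ∈ f (g⁻¹ • x) := by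
  change y ∈ (f (g⁻¹ • x)).map (fun y => g • y) ↔ _
  rw [Part.mem_map_iff]
  constructor
  · rintro ⟨z, hz, rfl⟩
    rwa [inv_smul_smul]
  · intro h
    exact ⟨_, h, smul_inv_smul _ _⟩

theorem smul_mem_pfun {g : FinPerm 𝔸} {f : X →. Y} {x : X} {y : Y} (hg : g • f = f) :
    g • y ∈ f (g • x) ↔ y ∈ f x := by
  conv_lhs => rw [← hg]
  rw [mem_smul_pfun, inv_smul_smul, inv_smul_smul]

variable (𝔸) in
/-- Separating partial functions. -/
structure IsSeparating (f : X →. Y) : Prop where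
  finSupp : FinSupp 𝔸 (FinPerm 𝔸) f
  dom_iff : ∀ x, (f x).Dom ↔ Separated 𝔸 f x
  supp_eq : supp 𝔸 (FinPerm 𝔸) f =
    ⋃ (x : X) (h : (f x).Dom), supp 𝔸 (FinPerm 𝔸) ((f x).get h) \ supp 𝔸 (FinPerm 𝔸) x

theorem mem_iUnion_supp {f : X →. Y} {a : 𝔸} :
    (a ∈ ⋃ (x : X) (h : (f x).Dom), supp 𝔸 (FinPerm 𝔸) ((f x).get h) \ supp 𝔸 (FinPerm 𝔸) x) ↔
    ∃ x, ∃ y ∈ f x, a ∈ supp 𝔸 (FinPerm 𝔸) y ∧ a ∉ supp 𝔸 (FinPerm 𝔸) x := by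
  simp only [Set.mem_iUnion, Set.mem_sdiff]
  constructor
  · rintro ⟨x, h, h1, h2⟩
    exact ⟨x, _, Part.get_mem h, h1, h2⟩
  · rintro ⟨x, y, ⟨h, rfl⟩, h1, h2⟩
    exact ⟨x, h, h1, h2⟩

theorem IsSeparating.mem_supp {f : X →. Y} (hf : IsSeparating 𝔸 f) {a : 𝔸} :
    a ∈ supp 𝔸 (FinPerm 𝔸) f ↔
      ∃ x, ∃ y ∈ f x, a ∈ supp 𝔸 (FinPerm 𝔸) y ∧ a ∉ supp 𝔸 (FinPerm 𝔸) x := by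
  rw [hf.supp_eq, mem_iUnion_supp]

theorem Separated.smul {x : X} {y : Y} (h : Separated 𝔸 x y) (g : FinPerm 𝔸) :
    Separated 𝔸 (g • x) (g • y) := by
  classical
  obtain ⟨C, D, hCD, hC, hD⟩ := h
  refine ⟨C.image (fun a => g • a), D.image (fun a => g • a), ?_, ?_, ?_⟩
  · rwa [Finset.disjoint_image (MulAction.injective g)]
  · rw [Finset.coe_image]; exact hC.smul g
  · rw [Finset.coe_image]; exact hD.smul g

theorem IsSeparating.smul {f : X →. Y} (hf : IsSeparating 𝔸 f) (g : FinPerm 𝔸) :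
    IsSeparating 𝔸 (g • f) where
  finSupp := hf.finSupp.smul g
  dom_iff x := by
    change (f (g⁻¹ • x)).Dom ↔ _
    rw [hf.dom_iff]
    constructor
    · intro h
      simpa using h.smul g
    · intro h
      simpa using h.smul g⁻¹
  supp_eq := by
    ext a
    rw [mem_iUnion_supp, mem_supp_smul, hf.mem_supp]
    constructor
    · rintro ⟨x, y, hy, h1, h2⟩
      refine ⟨g • x, g • y, ?_, ?_, ?_⟩
      · rw [mem_smul_pfun, inv_smul_smul, inv_smul_smul]; exact hy
      · rwa [mem_supp_smul]
      · rwa [mem_supp_smul]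
    · rintro ⟨x, y, hy, h1, h2⟩
      refine ⟨g⁻¹ • x, g⁻¹ • y, mem_smul_pfun.1 hy, ?_, ?_⟩
      · rwa [smul_mem_supp_smul]
      · rwa [smul_mem_supp_smul]

end PermFacts2

/-- The elements of the magic wand: separating partial functions. -/
@[ext] structure Wand {𝔸 : Type u} (X Y : PermNom 𝔸) where
  toPFun : X.carrier →. Y.carrier
  isSeparating : IsSeparating 𝔸 toPFun

instance {𝔸 : Type u} (X Y : PermNom 𝔸) : MulAction (FinPerm 𝔸) (Wand X Y) where
  smul g f := ⟨g • f.1, f.2.smul g⟩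
  one_smul f := Wand.ext (one_smul (FinPerm 𝔸) f.1)
  mul_smul g h f := Wand.ext (mul_smul g h f.1)

/-- The magic wand: the nominal `Perm`-set of separating partial functions. -/
def wandObj {𝔸 : Type u} (X Y : PermNom 𝔸) : PermNom 𝔸 where
  carrier := Wand X Y
  finSupp f := by
    obtain ⟨C, hC⟩ := f.2.finSupp
    exact ⟨C, fun m₁ m₂ h => Wand.ext (hC m₁ m₂ h)⟩

section WandMap

variable {𝔸 : Type u} [Infinite 𝔸] {X Y : PermNom 𝔸}

theorem exists_fresh_move {S A : Finset 𝔸} {x : X.carrier}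
    (h : ∀ a ∈ S, a ∉ supp 𝔸 (FinPerm 𝔸) x) :
    ∃ g : FinPerm 𝔸, (∀ a ∈ S, g • a = a) ∧ ∀ a ∈ A, a ∉ supp 𝔸 (FinPerm 𝔸) (g • x) := by
  obtain ⟨B, hB, -⟩ := (X.finSupp x).exists_supp
  obtain ⟨g, hg1, hg2⟩ := exists_perm_fresh S B A
  refine ⟨g, hg1, fun a ha hax => ?_⟩
  rw [mem_supp_smul] at hax
  have h1 : g⁻¹ • a ∈ B := by
    have : g⁻¹ • a ∈ (B : Set 𝔸) := by rw [hB]; exact hax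
    exact this
  have := hg2 _ h1 (fun hS => h _ hS hax)
  rw [smul_inv_smul] at this
  exact this ha

theorem IsSeparating.dom_iff' {f : X.carrier →. Y.carrier} (hf : IsSeparating 𝔸 f)
    {x : X.carrier} :
    (f x).Dom ↔ ∀ a ∈ supp 𝔸 (FinPerm 𝔸) f, a ∉ supp 𝔸 (FinPerm 𝔸) x := by
  rw [hf.dom_iff, separated_iff hf.finSupp (X.finSupp x)]

theorem IsSeparating.supp_le {f f' : X.carrier →. Y.carrier} (hf : IsSeparating 𝔸 f)
    (hf' : IsSeparating 𝔸 f') (A : Finset 𝔸)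
    (h : ∀ x, (∀ a ∈ A, a ∉ supp 𝔸 (FinPerm 𝔸) x) → f x = f' x) :
    supp 𝔸 (FinPerm 𝔸) f ⊆ supp 𝔸 (FinPerm 𝔸) f' := by
  intro a ha
  obtain ⟨x, y, hy, hay, hax⟩ := hf.mem_supp.1 ha
  obtain ⟨S, hS, hSf⟩ := hf.finSupp.exists_supp
  have hx : ∀ b ∈ S, b ∉ supp 𝔸 (FinPerm 𝔸) x := fun b hb =>
    hf.dom_iff'.1 (Part.dom_iff_mem.2 ⟨y, hy⟩) b (by rw [← hS]; exact hb)
  obtain ⟨g, hg1, hg2⟩ := exists_fresh_move (A := A) hx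
  have hgf : g • f = f := supports_iff.1 hSf g hg1
  have hga : g • a = a := hg1 a (by rw [← hS] at ha; exact ha)
  have h1 : g • y ∈ f (g • x) := (smul_mem_pfun hgf).2 hy
  rw [h _ hg2] at h1
  rw [hf'.mem_supp]
  refine ⟨_, _, h1, ?_, ?_⟩
  · rw [← hga, smul_mem_supp_smul]; exact hay
  · rw [← hga, smul_mem_supp_smul]; exact hax

/-- Separating functions are determined by their values on sufficiently fresh arguments. -/
theorem IsSeparating.eq_of_fresh {f f' : X.carrier →. Y.carrier} (hf : IsSeparating 𝔸 f)
    (hf' : IsSeparating 𝔸 f') (A : Finset 𝔸)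
    (h : ∀ x, (∀ a ∈ A, a ∉ supp 𝔸 (FinPerm 𝔸) x) → f x = f' x) : f = f' := by
  have hsupp : supp 𝔸 (FinPerm 𝔸) f = supp 𝔸 (FinPerm 𝔸) f' :=
    Set.Subset.antisymm (hf.supp_le hf' A h) (hf'.supp_le hf A fun x hx => (h x hx).symm)
  funext x
  by_cases hx : ∀ a ∈ supp 𝔸 (FinPerm 𝔸) f, a ∉ supp 𝔸 (FinPerm 𝔸) x
  · obtain ⟨S, hS, hSf⟩ := hf.finSupp.exists_supp
    have hSf' : Supports (FinPerm 𝔸) (S : Set 𝔸) f' := by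
      rw [hS, hsupp]; exact hf'.finSupp.supports_supp
    obtain ⟨g, hg1, hg2⟩ := exists_fresh_move (S := S) (A := A) (x := x)
      (fun a ha => hx a (by rw [← hS]; exact ha))
    have hgf : g • f = f := supports_iff.1 hSf g hg1
    have hgf' : g • f' = f' := supports_iff.1 hSf' g hg1
    ext y
    rw [← smul_mem_pfun hgf, ← smul_mem_pfun hgf', h _ hg2]
  · have h1 : f x = Part.none := Part.eq_none_iff'.2 fun hd => hx (hf.dom_iff'.1 hd)
    have h2 : f' x = Part.none := Part.eq_none_iff'.2 fun hd =>
      hx (by rw [hsupp]; exact hf'.dom_iff'.1 hd)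
    rw [h1, h2]

open Classical in
/-- A finitely supported partial function that is defined on all sufficiently fresh arguments
agrees with a separating function on sufficiently fresh arguments. -/
theorem exists_separating (p : X.carrier →. Y.carrier) (A : Finset 𝔸)
    (hA : Supports (FinPerm 𝔸) (A : Set 𝔸) p)
    (hp : ∀ x, (∀ a ∈ A, a ∉ supp 𝔸 (FinPerm 𝔸) x) → (p x).Dom) :
    ∃ w : X.carrier →. Y.carrier, IsSeparating 𝔸 w ∧
      ∀ x, (∀ a ∈ A, a ∉ supp 𝔸 (FinPerm 𝔸) x) → w x = p x := by
  have hA' := supports_iff.1 hA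
  -- values of `p` are supported by `A` together with the support of the argument
  have hval : ∀ x, ∀ y ∈ p x, ∀ a ∈ supp 𝔸 (FinPerm 𝔸) y, a ∉ supp 𝔸 (FinPerm 𝔸) x → a ∈ A := by
    intro x y hy a ha hax
    obtain ⟨T, hT, hTx⟩ := (X.finSupp x).exists_supp
    have h1 : Supports (FinPerm 𝔸) ((A ∪ T : Finset 𝔸) : Set 𝔸) y := by
      rw [supports_iff]
      intro g hg
      have hgp : g • p = p := hA' g fun a ha => hg a (by simp [Finset.mem_coe.1 ha])
      have hgx : g • x = x :=
        supports_iff.1 hTx g fun a ha => hg a (by simp [Finset.mem_coe.1 ha])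
      have h2 := (smul_mem_pfun (x := x) hgp).2 hy
      rw [hgx] at h2
      exact Part.mem_unique h2 hy
    have h3 := Finset.mem_union.1 (ha _ h1)
    rcases h3 with h3 | h3
    · exact h3
    · exact absurd (by rw [← hT]; exact h3) hax
  let S : Finset 𝔸 := A.filter fun a => ∃ x, (∀ b ∈ A, b ∉ supp 𝔸 (FinPerm 𝔸) x) ∧
    ∃ y ∈ p x, a ∈ supp 𝔸 (FinPerm 𝔸) y ∧ a ∉ supp 𝔸 (FinPerm 𝔸) x
  have hSA : ∀ a ∈ S, a ∈ A := fun a ha => (Finset.mem_filter.1 ha).1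
  have hS : ∀ x, (∀ b ∈ A, b ∉ supp 𝔸 (FinPerm 𝔸) x) → ∀ y ∈ p x,
      ∀ a ∈ supp 𝔸 (FinPerm 𝔸) y, a ∉ supp 𝔸 (FinPerm 𝔸) x → a ∈ S := by
    intro x hx y hy a ha hax
    exact Finset.mem_filter.2 ⟨hval x y hy a ha hax, x, hx, y, hy, ha, hax⟩
  let R : X.carrier → Y.carrier → Prop := fun x y => ∃ g : FinPerm 𝔸, (∀ a ∈ S, g • a = a) ∧
    (∀ a ∈ A, a ∉ supp 𝔸 (FinPerm 𝔸) (g • x)) ∧ g • y ∈ p (g • x)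
  -- on fresh arguments, `p` is equivariant with respect to permutations fixing `S`
  have hequi : ∀ (x : X.carrier) (y : Y.carrier) (t : FinPerm 𝔸), (∀ a ∈ S, t • a = a) →
      (∀ a ∈ A, a ∉ supp 𝔸 (FinPerm 𝔸) x) → (∀ a ∈ A, a ∉ supp 𝔸 (FinPerm 𝔸) (t • x)) →
      y ∈ p x → t • y ∈ p (t • x) := by
    intro x y t ht hx htx hy
    obtain ⟨T, hT, hTx⟩ := (X.finSupp x).exists_supp
    have hTmem : ∀ a, a ∈ T ↔ a ∈ supp 𝔸 (FinPerm 𝔸) x := by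
      intro a; rw [← hT]; exact Finset.mem_coe.symm
    have hinj : Set.InjOn (fun a => if a ∈ A then a else t • a) ((A ∪ T : Finset 𝔸) : Set 𝔸) := by
      have aux : ∀ b ∈ T, t • b ∉ A := by
        intro b hb hbA
        exact htx _ hbA (mem_supp_smul_of_mem t ((hTmem b).1 hb))
      intro a ha b hb hab
      have ha := Finset.mem_union.1 (Finset.mem_coe.1 ha)
      have hb := Finset.mem_union.1 (Finset.mem_coe.1 hb)
      by_cases h1 : a ∈ A <;> by_cases h2 : b ∈ A <;> simp only [h1, h2, if_true, if_false] at hab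
      · exact hab
      · exact absurd (hab ▸ h1) (aux b (hb.resolve_left h2))
      · exact absurd (hab.symm ▸ h2) (aux a (ha.resolve_left h1))
      · exact MulAction.injective t hab
    obtain ⟨g, hg⟩ := exists_perm_extend (A ∪ T) _ hinj
    have hgA : ∀ a ∈ A, g • a = a := fun a ha => by
      rw [hg a (Finset.mem_union_left _ ha), if_pos ha]
    have hgT : ∀ a ∈ T, g • a = t • a := fun a ha => by
      rw [hg a (Finset.mem_union_right _ ha), if_neg fun h => hx a h ((hTmem a).1 ha)]
    have hgp : g • p = p := hA' g hgA
    have hgx : g • x = t • x := hTx _ _ hgT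
    have hgy : g • y = t • y := by
      refine (Y.finSupp y).supports_supp _ _ fun a ha => ?_
      by_cases hax : a ∈ supp 𝔸 (FinPerm 𝔸) x
      · exact hgT a ((hTmem a).2 hax)
      · have haS := hS x hx y hy a ha hax
        rw [hgA a (hSA a haS), ht a haS]
    rw [← hgx, ← hgy]
    exact (smul_mem_pfun hgp).2 hy
  have hRuniq : ∀ x y y', R x y → R x y' → y = y' := by
    rintro x y y' ⟨g, hg1, hg2, hg3⟩ ⟨g', hg1', hg2', hg3'⟩
    have h1 := hequi (g • x) (g • y) (g' * g⁻¹) (fun a ha => by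
      rw [mul_smul, inv_smul_eq_iff.2 (hg1 a ha).symm, hg1' a ha]) hg2
      (by rwa [mul_smul, inv_smul_smul]) hg3
    rw [mul_smul, mul_smul, inv_smul_smul, inv_smul_smul] at h1
    exact MulAction.injective g' (Part.mem_unique h1 hg3')
  have hRdom : ∀ x, (∃ y, R x y) ↔ ∀ a ∈ S, a ∉ supp 𝔸 (FinPerm 𝔸) x := by
    intro x
    constructor
    · rintro ⟨y, g, hg1, hg2, -⟩ a ha hax
      refine hg2 a (hSA a ha) ?_
      have := mem_supp_smul_of_mem g hax
      rwa [hg1 a ha] at this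
    · intro h
      obtain ⟨g, hg1, hg2⟩ := exists_fresh_move (A := A) h
      obtain ⟨y, hy⟩ := Part.dom_iff_mem.1 (hp _ hg2)
      exact ⟨g⁻¹ • y, g, hg1, hg2, by rwa [smul_inv_smul]⟩
  have hRequi : ∀ t : FinPerm 𝔸, (∀ a ∈ S, t • a = a) → ∀ x y, R x y → R (t • x) (t • y) := by
    rintro t ht x y ⟨g, hg1, hg2, hg3⟩
    refine ⟨g * t⁻¹, fun a ha => ?_, ?_, ?_⟩
    · rw [mul_smul, inv_smul_eq_iff.2 (ht a ha).symm, hg1 a ha]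
    · rwa [mul_smul, inv_smul_smul]
    · rwa [mul_smul, mul_smul, inv_smul_smul, inv_smul_smul]
  let w : X.carrier →. Y.carrier := fun x => ⟨∃ y, R x y, fun h => Classical.choose h⟩
  have hw : ∀ x y, y ∈ w x ↔ R x y := by
    intro x y
    constructor
    · rintro ⟨h, rfl⟩
      exact Classical.choose_spec h
    · intro h
      exact ⟨⟨y, h⟩, hRuniq x _ _ (Classical.choose_spec (⟨y, h⟩ : ∃ y, R x y)) h⟩
  have hwS : Supports (FinPerm 𝔸) (S : Set 𝔸) w := by
    rw [supports_iff]
    intro t ht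
    have ht' : ∀ a ∈ S, t⁻¹ • a = a := fun a ha => inv_smul_eq_iff.2 (ht a ha).symm
    funext x
    ext y
    rw [mem_smul_pfun, hw, hw]
    constructor
    · intro h
      simpa using hRequi t ht _ _ h
    · exact hRequi t⁻¹ ht' _ _
  have hwp : ∀ x, (∀ a ∈ A, a ∉ supp 𝔸 (FinPerm 𝔸) x) → w x = p x := by
    intro x hx
    ext y
    rw [hw]
    constructor
    · intro h
      obtain ⟨z, hz⟩ := Part.dom_iff_mem.1 (hp x hx)
      have h2 : R x z := ⟨1, fun a _ => one_smul _ a, by rwa [one_smul], by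
        rwa [one_smul, one_smul]⟩
      rwa [hRuniq x y z h h2]
    · intro h
      exact ⟨1, fun a _ => one_smul _ a, by rwa [one_smul], by rwa [one_smul, one_smul]⟩
  have hfs : FinSupp 𝔸 (FinPerm 𝔸) w := ⟨S, hwS⟩
  have hsub : supp 𝔸 (FinPerm 𝔸) w ⊆ S := supp_subset hwS
  have hS_T : ∀ a ∈ S, ∃ x, ∃ y ∈ w x, a ∈ supp 𝔸 (FinPerm 𝔸) y ∧
      a ∉ supp 𝔸 (FinPerm 𝔸) x := by
    intro a ha
    obtain ⟨-, x, hx, y, hy, h1, h2⟩ := Finset.mem_filter.1 ha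
    exact ⟨x, y, by rwa [hwp x hx], h1, h2⟩
  have hT_supp : ∀ a, (∃ x, ∃ y ∈ w x, a ∈ supp 𝔸 (FinPerm 𝔸) y ∧
      a ∉ supp 𝔸 (FinPerm 𝔸) x) → a ∈ supp 𝔸 (FinPerm 𝔸) w := by
    rintro a ⟨x, y, hy, hay, hax⟩
    obtain ⟨T, hT, hTx⟩ := (X.finSupp x).exists_supp
    obtain ⟨V, hV, hVw⟩ := hfs.exists_supp
    have h1 : Supports (FinPerm 𝔸) ((V ∪ T : Finset 𝔸) : Set 𝔸) y := by
      rw [supports_iff]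
      intro g hg
      have hgw : g • w = w :=
        supports_iff.1 hVw g fun a ha => hg a (by simp [Finset.mem_coe.1 ha])
      have hgx : g • x = x :=
        supports_iff.1 hTx g fun a ha => hg a (by simp [Finset.mem_coe.1 ha])
      have h2 := (smul_mem_pfun (x := x) hgw).2 hy
      rw [hgx] at h2
      exact Part.mem_unique h2 hy
    rcases Finset.mem_union.1 (hay _ h1) with h3 | h3
    · rw [← hV]; exact h3
    · exact absurd (by rw [← hT]; exact h3) hax
  have hsuppS : supp 𝔸 (FinPerm 𝔸) w = S :=
    Set.Subset.antisymm hsub fun a ha => hT_supp a (hS_T a ha)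
  refine ⟨w, ⟨hfs, fun x => ?_, ?_⟩, hwp⟩
  · rw [separated_iff hfs (X.finSupp x), hsuppS]
    exact hRdom x
  · ext a
    rw [mem_iUnion_supp]
    exact ⟨fun ha => hS_T a (hsub ha), hT_supp a⟩

variable {X' Y' : PermNom 𝔸}

theorem exists_wandMap (h : X' ⟶ X) (k : Y ⟶ Y') (w : Wand X Y) :
    ∃ v : Wand X' Y',
      ∀ x, Separated 𝔸 w.1 x → v.1 x = (w.1 (Nom.ap h x)).map (Nom.ap k) := by
  obtain ⟨A, hA, hAw⟩ := w.2.finSupp.exists_supp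
  have hsep : ∀ x : X'.carrier, Separated 𝔸 w.1 x ↔ ∀ a ∈ A, a ∉ supp 𝔸 (FinPerm 𝔸) x := by
    intro x
    rw [separated_iff w.2.finSupp (X'.finSupp x), ← hA]
    rfl
  obtain ⟨v, hv1, hv2⟩ := exists_separating (X := X') (Y := Y')
    (fun x => (w.1 (Nom.ap h x)).map (Nom.ap k)) A
    (by
      refine supports_iff.2 ?_
      intro g hg
      have hgw : g • w.1 = w.1 := supports_iff.1 hAw g hg
      funext x
      ext y
      refine mem_smul_pfun.trans ((Part.mem_map_iff _).trans
        (Iff.trans ?_ (Part.mem_map_iff _).symm))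
      constructor
      · rintro ⟨z, hz, hzy⟩
        refine ⟨g • z, ?_, ?_⟩
        · rw [Nom.ap_smul] at hz
          have := (smul_mem_pfun hgw).2 hz
          rwa [smul_inv_smul] at this
        · rw [Nom.ap_smul, hzy, smul_inv_smul]
      · rintro ⟨z, hz, hzy⟩
        refine ⟨g⁻¹ • z, ?_, ?_⟩
        · rw [Nom.ap_smul, ← smul_mem_pfun hgw, smul_inv_smul, smul_inv_smul]
          exact hz
        · rw [Nom.ap_smul, hzy])
    (fun x hx => by
      change (w.1 (Nom.ap h x)).Dom
      rw [w.2.dom_iff', ← hA]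
      intro a ha hax
      obtain ⟨T, hT, hTx⟩ := (X'.finSupp x).exists_supp
      have h1 := supp_subset (hTx.map h) hax
      rw [hT] at h1
      exact hx a ha h1)
  exact ⟨⟨v, hv1⟩, fun x hx => hv2 x ((hsep x).1 hx)⟩

/-- The functorial action of the magic wand: `wandMap h k w` is the separating function that
sends `x` to `k (w (h x))` for all `x` separated from `w`; it is unique. -/
noncomputable def wandMap (h : X' ⟶ X) (k : Y ⟶ Y') (w : Wand X Y) :
    Wand X' Y' :=
  Classical.choose (exists_wandMap h k w)

theorem wandMap_spec (h : X' ⟶ X) (k : Y ⟶ Y') (w : Wand X Y) (x : X'.carrier)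
    (hx : Separated 𝔸 w.1 x) :
    (wandMap h k w).1 x = (w.1 (Nom.ap h x)).map (Nom.ap k) :=
  Classical.choose_spec (exists_wandMap h k w) x hx

theorem wand_ext {v v' : Wand X Y} (A : Finset 𝔸)
    (h : ∀ x, (∀ a ∈ A, a ∉ supp 𝔸 (FinPerm 𝔸) x) → v.1 x = v'.1 x) : v = v' :=
  Wand.ext (v.2.eq_of_fresh v'.2 A h)

theorem wandMap_smul (h : X' ⟶ X) (k : Y ⟶ Y') (g : FinPerm 𝔸) (w : Wand X Y) :
    wandMap h k (g • w) = g • wandMap h k w := by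
  obtain ⟨A, hA, -⟩ := (g • w).2.finSupp.exists_supp
  refine wand_ext A fun x hx => ?_
  have hsep : Separated 𝔸 (g • w).1 x := by
    rw [separated_iff (g • w).2.finSupp (X'.finSupp x), ← hA]
    exact hx
  rw [wandMap_spec h k (g • w) x hsep]
  have hsep' : Separated 𝔸 w.1 (g⁻¹ • x) := by
    have := Separated.smul (x := (g • w).1) hsep g⁻¹
    change Separated 𝔸 (g⁻¹ • g • w.1) (g⁻¹ • x) at this
    rwa [inv_smul_smul] at this
  change ((w.1 (g⁻¹ • Nom.ap h x)).map _).map _ = ((wandMap h k w).1 (g⁻¹ • x)).map _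
  rw [wandMap_spec h k w _ hsep', Part.map_map, Part.map_map, Nom.ap_smul]
  congr 1
  funext y
  exact Nom.ap_smul k g y

theorem wandMap_id (w : Wand X Y) : wandMap (𝟙 X) (𝟙 Y) w = w := by
  obtain ⟨A, hA, -⟩ := w.2.finSupp.exists_supp
  refine wand_ext A fun x hx => ?_
  have hsep : Separated 𝔸 w.1 x := by
    rw [separated_iff w.2.finSupp (X.finSupp x), ← hA]
    exact hx
  rw [wandMap_spec _ _ _ x hsep]
  exact Part.map_id' (fun _ => rfl) _

open Classical in
theorem wandMap_comp {X'' Y'' : PermNom 𝔸} (h' : X'' ⟶ X') (h : X' ⟶ X) (k : Y ⟶ Y')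
    (k' : Y' ⟶ Y'') (w : Wand X Y) :
    wandMap (h' ≫ h) (k ≫ k') w = wandMap h' k' (wandMap h k w) := by
  obtain ⟨A, hA, -⟩ := w.2.finSupp.exists_supp
  obtain ⟨B, hB, -⟩ := (wandMap h k w).2.finSupp.exists_supp
  refine wand_ext (A ∪ B) fun x hx => ?_
  have hA' : ∀ a ∈ supp 𝔸 (FinPerm 𝔸) w.1, a ∉ supp 𝔸 (FinPerm 𝔸) x := by
    rw [← hA]
    exact fun a ha => hx a (Finset.mem_union_left _ ha)
  have hsep : Separated 𝔸 w.1 x := (separated_iff w.2.finSupp (X''.finSupp x)).2 hA'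
  have hsepB : Separated 𝔸 (wandMap h k w).1 x := by
    rw [separated_iff (wandMap h k w).2.finSupp (X''.finSupp x), ← hB]
    exact fun a ha => hx a (Finset.mem_union_right _ ha)
  have hsep' : Separated 𝔸 w.1 (Nom.ap h' x) := by
    obtain ⟨C, D, hCD, hC, hD⟩ := hsep
    exact ⟨C, D, hCD, hC, hD.map h'⟩
  rw [wandMap_spec _ _ _ x hsep, wandMap_spec _ _ _ x hsepB, wandMap_spec _ _ _ _ hsep',
    Part.map_map]
  rfl

end WandMap

/-- The magic wand as a functor, contravariant in the first argument. -/
noncomputable def wandFunctor (𝔸 : Type u) [Infinite 𝔸] :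
    (PermNom 𝔸)ᵒᵖ ⥤ PermNom 𝔸 ⥤ PermNom 𝔸 where
  obj X :=
    { obj := fun Y => wandObj X.unop Y
      map := fun {Y Y'} k => Nom.mkHom (fun w => wandMap (𝟙 X.unop) k w)
        (fun g w => wandMap_smul _ _ g w)
      map_id := fun Y => Nom.hom_ext fun w => wandMap_id w
      map_comp := fun k k' => Nom.hom_ext fun w => by
        have h1 := wandMap_comp (𝟙 X.unop) (𝟙 X.unop) k k' w
        rw [Category.comp_id] at h1
        exact h1 }
  map {X X'} h :=
    { app := fun Y => Nom.mkHom (fun w => wandMap h.unop (𝟙 Y) w)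
        (fun g w => wandMap_smul _ _ g w)
      naturality := fun Y Y' k => Nom.hom_ext fun w => by
        have h1 := wandMap_comp h.unop (𝟙 X.unop) k (𝟙 Y') w
        have h2 := wandMap_comp (𝟙 X'.unop) h.unop (𝟙 Y) k w
        simp only [Category.comp_id, Category.id_comp] at h1 h2
        exact h1.symm.trans h2 }
  map_id X := by
    ext Y
    exact Nom.hom_ext fun w => wandMap_id w
  map_comp {X X' X''} h h' := by
    ext Y
    refine Nom.hom_ext fun w => ?_
    have h1 := wandMap_comp h'.unop h.unop (𝟙 Y) (𝟙 Y) w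
    rw [Category.comp_id] at h1
    exact h1

/-! ### Name abstraction -/

section Abstraction

variable {𝔸 : Type u}

/-- Alpha-equivalence on `𝔸 × Y`: `(a, y) ∼ (a', y')` iff `(a b) · y = (a' b) · y'` for some
atom `b` fresh for `a`, `y`, `a'`, `y'`. -/
def AlphaEquiv (Y : PermNom 𝔸) (p q : 𝔸 × Y.carrier) : Prop :=
  ∃ b : 𝔸, b ≠ p.1 ∧ b ∉ supp 𝔸 (FinPerm 𝔸) p.2 ∧ b ≠ q.1 ∧ b ∉ supp 𝔸 (FinPerm 𝔸) q.2 ∧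
    FinPerm.swap p.1 b • p.2 = FinPerm.swap q.1 b • q.2

theorem FinPerm.conj_swap (g : FinPerm 𝔸) (a b : 𝔸) :
    g * FinPerm.swap a b = FinPerm.swap (g • a) (g • b) * g := by
  classical
  apply Subtype.ext
  change (g : Equiv.Perm 𝔸) * Equiv.swap a b = Equiv.swap (g.1 a) (g.1 b) * g.1
  convert Equiv.mul_swap_eq_swap_mul g.1 a b

theorem FinPerm.swap_smul_of_ne {a b c : 𝔸} (h1 : c ≠ a) (h2 : c ≠ b) :
    FinPerm.swap a b • c = c := by
  classical
  exact Equiv.swap_apply_of_ne_of_ne h1 h2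

theorem FinPerm.swap_smul_left (a b : 𝔸) : FinPerm.swap a b • a = b := by
  classical
  exact Equiv.swap_apply_left a b

theorem AlphaEquiv.smul {Y : PermNom 𝔸} {p q : 𝔸 × Y.carrier} (h : AlphaEquiv Y p q)
    (g : FinPerm 𝔸) : AlphaEquiv Y (g • p) (g • q) := by
  obtain ⟨b, h1, h2, h3, h4, h⟩ := h
  refine ⟨g • b, fun e => h1 (MulAction.injective g e), ?_, fun e => h3 (MulAction.injective g e),
    ?_, ?_⟩
  · exact fun e => h2 ((smul_mem_supp_smul g).1 e)
  · exact fun e => h4 ((smul_mem_supp_smul g).1 e)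
  · change FinPerm.swap (g • p.1) (g • b) • g • p.2 = FinPerm.swap (g • q.1) (g • b) • g • q.2
    rw [smul_smul, ← FinPerm.conj_swap, smul_smul, ← FinPerm.conj_swap, mul_smul, mul_smul, h]

variable [Infinite 𝔸]

theorem swap_smul_of_fresh {Y : PermNom 𝔸} {y : Y.carrier} {b c : 𝔸}
    (hb : b ∉ supp 𝔸 (FinPerm 𝔸) y) (hc : c ∉ supp 𝔸 (FinPerm 𝔸) y) :
    FinPerm.swap b c • y = y :=
  smul_eq_of_supp (Y.finSupp y) fun _ ha =>
    FinPerm.swap_smul_of_ne (fun h => hb (h ▸ ha)) (fun h => hc (h ▸ ha))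

theorem AlphaEquiv.rename {Y : PermNom 𝔸} {y : Y.carrier} {a b c : 𝔸} (hb : b ≠ a) (hc : c ≠ a)
    (hby : b ∉ supp 𝔸 (FinPerm 𝔸) y) (hcy : c ∉ supp 𝔸 (FinPerm 𝔸) y) :
    FinPerm.swap b c • FinPerm.swap a b • y = FinPerm.swap a c • y := by
  rw [smul_smul, FinPerm.conj_swap, mul_smul, swap_smul_of_fresh hby hcy,
    FinPerm.swap_smul_left, FinPerm.swap_smul_of_ne hb.symm hc.symm]

theorem AlphaEquiv.all {Y : PermNom 𝔸} {p q : 𝔸 × Y.carrier} (h : AlphaEquiv Y p q) {c : 𝔸}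
    (h1 : c ≠ p.1) (h2 : c ∉ supp 𝔸 (FinPerm 𝔸) p.2) (h3 : c ≠ q.1)
    (h4 : c ∉ supp 𝔸 (FinPerm 𝔸) q.2) :
    FinPerm.swap p.1 c • p.2 = FinPerm.swap q.1 c • q.2 := by
  obtain ⟨b, hb1, hb2, hb3, hb4, hb⟩ := h
  rw [← AlphaEquiv.rename hb1 h1 hb2 h2, ← AlphaEquiv.rename hb3 h3 hb4 h4, hb]

theorem exists_fresh_atom (Y : PermNom 𝔸) (l : List (𝔸 × Y.carrier)) :
    ∃ b : 𝔸, ∀ p ∈ l, b ≠ p.1 ∧ b ∉ supp 𝔸 (FinPerm 𝔸) p.2 := by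
  have hfin : (⋃ p ∈ {p | p ∈ l}, ({p.1} ∪ supp 𝔸 (FinPerm 𝔸) p.2 : Set 𝔸)).Finite :=
    Set.Finite.biUnion (List.finite_toSet l) fun p _ =>
      (Set.finite_singleton _).union (supp_finite (Y.finSupp p.2))
  obtain ⟨b, hb⟩ := hfin.infinite_compl.nonempty
  refine ⟨b, fun p hp => ?_⟩
  have : b ∉ ({p.1} ∪ supp 𝔸 (FinPerm 𝔸) p.2 : Set 𝔸) := fun h =>
    hb (Set.mem_biUnion (show p ∈ {p | p ∈ l} from hp) h)
  simpa [not_or] using this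

/-- Alpha-equivalence is an equivalence relation. -/
def alphaSetoid (Y : PermNom 𝔸) : Setoid (𝔸 × Y.carrier) where
  r := AlphaEquiv Y
  iseqv :=
    { refl := fun p => by
        obtain ⟨b, hb⟩ := exists_fresh_atom Y [p]
        have := hb p (by simp)
        exact ⟨b, this.1, this.2, this.1, this.2, rfl⟩
      symm := fun ⟨b, h1, h2, h3, h4, h⟩ => ⟨b, h3, h4, h1, h2, h.symm⟩
      trans := fun {p q r} hpq hqr => by
        obtain ⟨b, hb⟩ := exists_fresh_atom Y [p, q, r]
        have h1 := hb p (by simp)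
        have h2 := hb q (by simp)
        have h3 := hb r (by simp)
        exact ⟨b, h1.1, h1.2, h3.1, h3.2,
          (hpq.all h1.1 h1.2 h2.1 h2.2).trans (hqr.all h2.1 h2.2 h3.1 h3.2)⟩ }

theorem AlphaEquiv.map {Y Z : PermNom 𝔸} (k : Y ⟶ Z) {p q : 𝔸 × Y.carrier}
    (h : AlphaEquiv Y p q) :
    AlphaEquiv Z (p.1, Nom.ap k p.2) (q.1, Nom.ap k q.2) := by
  have hsub : ∀ y : Y.carrier, ∀ b ∉ supp 𝔸 (FinPerm 𝔸) y,
      b ∉ supp 𝔸 (FinPerm 𝔸) (Nom.ap k y) := by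
    intro y b hb h
    obtain ⟨T, hT, hTy⟩ := (Y.finSupp y).exists_supp
    exact hb (by rw [← hT]; exact supp_subset (hTy.map k) h)
  obtain ⟨b, h1, h2, h3, h4, h⟩ := h
  refine ⟨b, h1, hsub _ b h2, h3, hsub _ b h4, ?_⟩
  change FinPerm.swap p.1 b • Nom.ap k p.2 = FinPerm.swap q.1 b • Nom.ap k q.2
  rw [← Nom.ap_smul, ← Nom.ap_smul, h]

/-- The nominal set of name abstractions `[𝔸]Y`: the quotient of `𝔸 × Y` by
alpha-equivalence. -/
def absObj (Y : PermNom 𝔸) : PermNom 𝔸 where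
  carrier := Quotient (alphaSetoid Y)
  act :=
    { smul := fun g => Quotient.map (fun p => g • p) (fun _ _ h => AlphaEquiv.smul h g)
      one_smul := by
        rintro ⟨p⟩
        exact congrArg (Quotient.mk (alphaSetoid Y)) (one_smul (FinPerm 𝔸) p)
      mul_smul := by
        rintro g h ⟨p⟩
        exact congrArg (Quotient.mk (alphaSetoid Y)) (mul_smul g h p) }
  finSupp := by
    classical
    rintro ⟨a, y⟩
    obtain ⟨C, hC⟩ := Y.finSupp y
    refine ⟨insert a C, fun g₁ g₂ h => ?_⟩
    refine congrArg (Quotient.mk (alphaSetoid Y)) (Prod.ext (h a (by simp)) ?_)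
    exact hC g₁ g₂ fun c hc => h c (by simp [Finset.mem_coe.1 hc])

/-- The name abstraction `[a]y`. -/
def absMk {Y : PermNom 𝔸} (a : 𝔸) (y : Y.carrier) : (absObj Y).carrier :=
  Quotient.mk (alphaSetoid Y) (a, y)

variable (𝔸) in
/-- Name abstraction as a functor: `[a]y ↦ [a](k y)`. -/
def absFunctor : PermNom 𝔸 ⥤ PermNom 𝔸 where
  obj Y := absObj Y
  map {Y Z} k := Nom.mkHom
    (Quotient.map (fun p => (p.1, Nom.ap k p.2)) (fun _ _ h => AlphaEquiv.map k h)) (by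
      rintro g ⟨a, y⟩
      exact congrArg (Quotient.mk (alphaSetoid Z)) (Prod.ext rfl (Nom.ap_smul k g y)))
  map_id Y := Nom.hom_ext (by rintro ⟨a, y⟩; rfl)
  map_comp k k' := Nom.hom_ext (by rintro ⟨a, y⟩; rfl)

end Abstraction

/-! ### The functors to be compared -/

/-- The property of nominal `Sb`-sets of being at most one-dimensional. -/
def dimLeOne (𝔸 : Type u) : ObjectProperty (SbNom 𝔸) := fun X => X.dim ≤ 1

/-- The category of nominal `Sb`-sets of dimension at most one. -/
abbrev SbNom₁ (𝔸 : Type u) := (dimLeOne 𝔸).FullSubcategory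

/-- The atoms as a one-dimensional nominal `Sb`-set. -/
def atoms₁ (𝔸 : Type u) : SbNom₁ 𝔸 := ⟨atoms 𝔸 (Sb 𝔸), dim_atoms_le⟩

/-- The bifunctor sending `X`, `Y` to the magic wand from `U X` to `U Y`, for `X` of dimension at
most one. -/
noncomputable def wandForget (𝔸 : Type u) [Infinite 𝔸] : (SbNom₁ 𝔸)ᵒᵖ ⥤ SbNom 𝔸 ⥤ PermNom 𝔸 :=
  ((dimLeOne 𝔸).ι ⋙ forgetSb 𝔸).op ⋙ wandFunctor 𝔸 ⋙
    (Functor.whiskeringLeft _ _ _).obj (forgetSb 𝔸)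

/-- The bifunctor sending `X`, `Y` to `U` of the exponent of `X` and `Y` in nominal `Sb`-sets,
for `X` of dimension at most one. -/
def forgetExp (𝔸 : Type u) : (SbNom₁ 𝔸)ᵒᵖ ⥤ SbNom 𝔸 ⥤ PermNom 𝔸 :=
  (dimLeOne 𝔸).ι.op ⋙ expFunctor ⋙ (Functor.whiskeringRight _ _ _).obj (forgetSb 𝔸)

section Eval

variable {𝔸 : Type u}

/-- `w`, a separating partial function from `X` to `Y`, is defined at `x` with value `y`. -/
def WandVal [Infinite 𝔸] {X : SbNom₁ 𝔸} {Y : SbNom 𝔸}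
    (w : (((wandForget 𝔸).obj (Opposite.op X)).obj Y).carrier)
    (x : X.obj.carrier) (y : Y.carrier) : Prop :=
  y ∈ (show Wand (forgetObj X.obj) (forgetObj Y) from w).toPFun x

/-- The value `f(m, x)` of an element `f` of the exponent. -/
def expVal {X : SbNom₁ 𝔸} {Y : SbNom 𝔸}
    (f : (((forgetExp 𝔸).obj (Opposite.op X)).obj Y).carrier)
    (m : Sb 𝔸) (x : X.obj.carrier) : Y.carrier :=
  (show NomExpo X.obj Y from f).toFun (m, x)

end Eval

end NomSets

/-! An element `f` of the exponent is recovered from `f(1, -)` on fresh arguments. Let `C` be a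
finite support of `f`. Then `f(m, x)` depends on `m` only through its restriction to `C`. Given `(m,
x)`, rename `x` to some `x'` whose support avoids `C`. Since a substitution may be prescribed
independently on disjoint sets, there is `m'` with `m' = m` on `C` and `m' • x' = x`
(`exists_fresh_lift`). Equivariance gives `f(m, x) = f(m', m' • x') = m' • f(1, x')`. On fresh
arguments `f(1, -)` coincides with a separating function, by `exists_separating`.

Conversely, a separating `w` is extended by the same formula: the value at `(m, x)` is `m' • w(x')`,
where `m'` agrees with `m` on the support of `w`. The crux is independence of the choice of `(m',
x')`, which is `WandExt.unique` and the place where dimension at most one enters. A substitution may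
identify atoms, so in general two preimages of `x` need not be related by a permutation. On a set
with at most one atom, however, every map is injective, so there `m'` acts on `x'` as a permutation
does. Two choices `x₁`, `x₂` then lie in one orbit, under a permutation that can be taken to fix the
support of `w`, and the `Perm`-equivariance of `w` compares the values. That comparison needs
`Perm`-supports to be `Sb`-supports, which is `Supports.toSb`.

For `X = 𝔸` a single fresh atom `a` determines `f`, so `[a]y` corresponds to `(m, c) ↦ m[a ↦ c] •
y`. Since `a` is fresh for this element, the matching separating function is defined at `a`, and its
value there is `y`. -/

namespace NomSets

/-! ### Supports under substitutions compared with supports under permutations. -/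

section SbSupport

variable {𝔸 : Type u}

open Classical in
/-- Any map on a finite set of atoms extends to a finite substitution. -/
theorem exists_sb_extend (C : Finset 𝔸) (f : 𝔸 → 𝔸) : ∃ m : Sb 𝔸, ∀ a ∈ C, m • a = f a := by
  refine ⟨⟨fun a => if a ∈ C then f a else a, C.finite_toSet.subset fun a ha => ?_⟩, ?_⟩
  · by_contra h
    exact ha (if_neg h)
  · intro a ha
    exact if_pos ha

-- Substitutions need not be injective, so two of them that agree on `C ∩ D` can be glued: `m`
-- equals `m₁` on `C` and `m₂` on `D`, whence `m₁ • x = m • x = m₂ • x`. No fresh atoms are needed,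
-- in contrast to the case of permutations.
open Classical in
theorem Supports.sb_inter {X : Type u} [MulAction (Sb 𝔸) X] {C D : Finset 𝔸} {x : X}
    (hC : Supports (Sb 𝔸) (C : Set 𝔸) x) (hD : Supports (Sb 𝔸) (D : Set 𝔸) x) :
    Supports (Sb 𝔸) ((C ∩ D : Finset 𝔸) : Set 𝔸) x := by
  intro m₁ m₂ h
  obtain ⟨m, hm⟩ := exists_sb_extend (C ∪ D) fun a => if a ∈ C then m₁ • a else m₂ • a
  have h1 : m₁ • x = m • x := hC _ _ fun a ha => by
    rw [hm a (Finset.mem_union_left _ ha), if_pos (Finset.mem_coe.1 ha)]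
  have h2 : m • x = m₂ • x := hD _ _ fun a ha => by
    rw [hm a (Finset.mem_union_right _ ha)]
    split_ifs with haC
    · exact h a (by simpa using ⟨haC, ha⟩)
    · rfl
  exact h1.trans h2

theorem Supports.toPerm {X : SbNom 𝔸} {C : Set 𝔸} {x : X.carrier}
    (h : Supports (Sb 𝔸) C x) :
    Supports (FinPerm 𝔸) (X := (forgetObj X).carrier) C x :=
  fun g₁ g₂ hg => h (FinPerm.toSb 𝔸 g₁) (FinPerm.toSb 𝔸 g₂) hg

open Classical in
/-- In a nominal `Sb`-set, finite supports for permutations are supports for substitutions. -/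
theorem Supports.toSb [Infinite 𝔸] {X : SbNom 𝔸} {C : Finset 𝔸} {x : X.carrier}
    (h : Supports (FinPerm 𝔸) (X := (forgetObj X).carrier) (C : Set 𝔸) x) :
    Supports (Sb 𝔸) (C : Set 𝔸) x := by
  obtain ⟨D, hD⟩ := X.finSupp x
  -- Here `g` fixes `C` and moves the rest of `D` off `D`. It fixes `x`, so both `D` and its image
  -- under `g` are `Sb`-supports; their intersection lies in `C`.
  obtain ⟨g, hg1, hg2⟩ := exists_perm_fresh C D D
  have hx : FinPerm.toSb 𝔸 g • x = x := supports_iff.1 h g hg1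
  have h1 := hD.smul (FinPerm.toSb 𝔸 g)
  rw [hx] at h1
  have h2 : Supports (Sb 𝔸) ((D.image (fun a => g • a) : Finset 𝔸) : Set 𝔸) x := by
    rw [Finset.coe_image]; exact h1
  refine (hD.sb_inter h2).mono fun a ha => ?_
  obtain ⟨haD, ha⟩ := Finset.mem_inter.1 (Finset.mem_coe.1 ha)
  obtain ⟨b, hb, rfl⟩ := Finset.mem_image.1 ha
  by_contra hbC
  refine hg2 b hb (fun hb' => hbC ?_) haD
  rw [hg1 b hb']
  exact hb'

open Classical in
/-- Every argument `x` of a substitution `m` is the image of a fresh `x'` under a substitution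
that agrees with `m` on a given finite set. -/
theorem exists_fresh_lift [Infinite 𝔸] {X : SbNom 𝔸} (A : Finset 𝔸) (m : Sb 𝔸) (x : X.carrier) :
    ∃ (m' : Sb 𝔸) (x' : X.carrier), (∀ a ∈ A, m' • a = m • a) ∧
      (∀ a ∈ A, a ∉ supp 𝔸 (FinPerm 𝔸) (X := (forgetObj X).carrier) x') ∧ m' • x' = x := by
  obtain ⟨T, hT⟩ := X.finSupp x
  obtain ⟨g, -, hg⟩ := exists_perm_fresh ∅ T A
  have hg : ∀ b ∈ T, g • b ∉ A := fun b hb => hg b hb (Finset.notMem_empty b)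
  -- The renamed support avoids `A`, so `m'` can follow `m` on `A` and still undo the renaming on
  -- `x' = g • x`.
  obtain ⟨m', hm'⟩ := exists_sb_extend (A ∪ T.image fun a => g • a)
    fun a => if a ∈ A then m • a else g⁻¹ • a
  refine ⟨m', FinPerm.toSb 𝔸 g • x, fun a ha => ?_, fun a ha hax => ?_, ?_⟩
  · rw [hm' a (Finset.mem_union_left _ ha), if_pos ha]
  · have h1 := hT.smul (FinPerm.toSb 𝔸 g)
    have h2 : Supports (Sb 𝔸) ((T.image (fun a => g • a) : Finset 𝔸) : Set 𝔸)
        (FinPerm.toSb 𝔸 g • x) := by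
      rw [Finset.coe_image]; exact h1
    obtain ⟨b, hb, rfl⟩ := Finset.mem_image.1 (hax _ h2.toPerm)
    exact hg b hb ha
  · rw [smul_smul]
    refine (hT _ 1 fun a ha => ?_).trans (one_smul _ x)
    rw [mul_smul, one_smul]
    change m' • g • a = a
    rw [hm' _ (Finset.mem_union_right _ (Finset.mem_image_of_mem _ ha)), if_neg (hg a ha),
      inv_smul_smul]

theorem exists_supp_card_le_one [Infinite 𝔸] {X : SbNom 𝔸} (hX : X.dim ≤ 1) (x : X.carrier) :
    ∃ T : Finset 𝔸, (T : Set 𝔸) = supp 𝔸 (FinPerm 𝔸) (X := (forgetObj X).carrier) x ∧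
      Supports (Sb 𝔸) (T : Set 𝔸) x ∧ T.card ≤ 1 := by
  obtain ⟨T, hT, hTx⟩ := ((forgetObj X).finSupp x).exists_supp
  refine ⟨T, hT, hTx.toSb, ?_⟩
  -- The dimension bounds least `Sb`-supports. Every `Sb`-support is a `Perm`-support, hence
  -- contains the least `Perm`-support `T`.
  have h1 : (T : Set 𝔸) ⊆ supp 𝔸 (Sb 𝔸) x := by
    rw [hT]
    exact fun a ha C hC => ha C hC.toPerm
  have h2 : (supp 𝔸 (Sb 𝔸) x).encard ≤ X.dim :=
    le_iSup (fun x : X.carrier => (supp 𝔸 (Sb 𝔸) x).encard) x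
  have h3 := (Set.encard_le_encard h1).trans (h2.trans hX)
  rw [Set.encard_coe_eq_coe_finsetCard] at h3
  exact_mod_cast h3

/-- A substitution acts on an element of a nominal set of dimension at most one like some
permutation. -/
theorem exists_perm_smul_eq {X : Type u} [MulAction (Sb 𝔸) X] {T : Finset 𝔸} {x : X}
    (hT : Supports (Sb 𝔸) (T : Set 𝔸) x) (hcard : T.card ≤ 1) (m : Sb 𝔸) :
    ∃ g : FinPerm 𝔸, (∀ a ∈ T, g • a = m • a) ∧ FinPerm.toSb 𝔸 g • x = m • x := by
  obtain ⟨g, hg⟩ := exists_perm_extend T (fun a => m • a)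
    fun a ha b hb _ => Finset.card_le_one.1 hcard a ha b hb
  exact ⟨g, hg, hT _ _ hg⟩

end SbSupport

/-! ### Extending a separating function to all pairs `(m, x)`. -/

section WandExt

variable {𝔸 : Type u} {X Y : SbNom 𝔸}

/-- The graph of the extension of a separating function `w` from `U X` to `U Y` to an element of
the exponent: the value at `(m, x)` is `m' • w x'`, where `m' • x' = x` and `m'` agrees with `m` on
the support of `w`. -/
def WandExt (w : Wand (forgetObj X) (forgetObj Y)) (m : Sb 𝔸) (x : X.carrier) (y : Y.carrier) :
    Prop :=
  ∃ (m' : Sb 𝔸) (x' : X.carrier) (y' : Y.carrier),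
    (∀ a ∈ supp 𝔸 (FinPerm 𝔸) w.toPFun, m' • a = m • a) ∧ y' ∈ w.toPFun x' ∧
      m' • x' = x ∧ m' • y' = y

theorem WandExt.congr {w : Wand (forgetObj X) (forgetObj Y)} {m n : Sb 𝔸} {x : X.carrier}
    {y : Y.carrier} (h : WandExt w m x y)
    (hmn : ∀ a ∈ supp 𝔸 (FinPerm 𝔸) w.toPFun, m • a = n • a) : WandExt w n x y := by
  obtain ⟨m', x', y', h1, h2, h3, h4⟩ := h
  exact ⟨m', x', y', fun a ha => (h1 a ha).trans (hmn a ha), h2, h3, h4⟩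

theorem WandExt.smul {w : Wand (forgetObj X) (forgetObj Y)} {m : Sb 𝔸} {x : X.carrier}
    {y : Y.carrier} (h : WandExt w m x y) (n : Sb 𝔸) : WandExt w (n * m) (n • x) (n • y) := by
  obtain ⟨m', x', y', h1, h2, rfl, rfl⟩ := h
  refine ⟨n * m', x', y', fun a ha => ?_, h2, mul_smul _ _ _, mul_smul _ _ _⟩
  rw [mul_smul, mul_smul, h1 a ha]

theorem WandExt.of_mem {w : Wand (forgetObj X) (forgetObj Y)} {x : X.carrier} {y : Y.carrier}
    (h : y ∈ w.toPFun x) : WandExt w 1 x y :=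
  ⟨1, x, y, fun _ _ => rfl, h, one_smul _ _, one_smul _ _⟩

/-- The extension is equivariant in the separating function. -/
theorem WandExt.smul_wand {w : Wand (forgetObj X) (forgetObj Y)} {g : FinPerm 𝔸} {m : Sb 𝔸}
    {x : X.carrier} {y : Y.carrier} (h : WandExt (g • w) m x y) :
    WandExt w (m * FinPerm.toSb 𝔸 g) x y := by
  obtain ⟨m', x', y', h1, h2, rfl, rfl⟩ := h
  -- Since `(g • w)(x') = g • w(g⁻¹ • x')`, the permutation `g` is shifted from the argument and
  -- value into the substitution.
  refine ⟨m' * FinPerm.toSb 𝔸 g, FinPerm.toSb 𝔸 g⁻¹ • x', FinPerm.toSb 𝔸 g⁻¹ • y',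
    fun a ha => ?_,
    (mem_smul_pfun (X := (forgetObj X).carrier) (Y := (forgetObj Y).carrier)).1 h2, ?_, ?_⟩
  · rw [mul_smul, mul_smul]
    exact h1 (g • a) (mem_supp_smul_of_mem g ha)
  · rw [smul_smul, mul_assoc, ← map_mul, mul_inv_cancel, map_one, mul_one]
  · rw [smul_smul, mul_assoc, ← map_mul, mul_inv_cancel, map_one, mul_one]

variable [Infinite 𝔸]

/-- The set `A` may exceed the support of `w`, so that one choice of `x'` can be made fresh for
several objects at once. -/
theorem exists_fresh_value (w : Wand (forgetObj X) (forgetObj Y)) (A : Finset 𝔸)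
    (hA : supp 𝔸 (FinPerm 𝔸) w.toPFun ⊆ A) (m : Sb 𝔸) (x : X.carrier) :
    ∃ (m' : Sb 𝔸) (x' : X.carrier) (y' : Y.carrier), (∀ a ∈ A, m' • a = m • a) ∧
      (∀ a ∈ A, a ∉ supp 𝔸 (FinPerm 𝔸) (X := (forgetObj X).carrier) x') ∧
      y' ∈ w.toPFun x' ∧ m' • x' = x := by
  obtain ⟨m', x', h1, h2, h3⟩ := exists_fresh_lift A m x
  obtain ⟨y', hy'⟩ := Part.dom_iff_mem.1
    ((w.isSeparating.dom_iff' (x := x')).2 fun a ha => h2 a (hA ha))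
  exact ⟨m', x', y', h1, h2, hy', h3⟩

theorem WandExt.exists (w : Wand (forgetObj X) (forgetObj Y)) (m : Sb 𝔸) (x : X.carrier) :
    ∃ y, WandExt w m x y := by
  obtain ⟨S, hS, -⟩ := w.isSeparating.finSupp.exists_supp
  obtain ⟨m', x', y', h1, -, h3, h4⟩ := exists_fresh_value w S hS.symm.subset m x
  exact ⟨m' • y', m', x', y', fun a ha => h1 a (by rwa [← hS] at ha), h3, h4, rfl⟩

-- Independence of choices. With at most one atom in each support, `m₁` and `m₂` act on `x₁` and
-- `x₂` like permutations `g₁` and `g₂`, so `g₂⁻¹ * g₁` sends `x₁` to `x₂`. Correcting it to a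
-- permutation `g` that fixes the support of `w` gives `g • z₁ = z₂`, and `m₁` agrees with `m₂ * g`
-- on a support of `z₁`.
open Classical in
theorem WandExt.unique (hX : X.dim ≤ 1) {w : Wand (forgetObj X) (forgetObj Y)} {m : Sb 𝔸}
    {x : X.carrier} {y₁ y₂ : Y.carrier} (h₁ : WandExt w m x y₁) (h₂ : WandExt w m x y₂) :
    y₁ = y₂ := by
  obtain ⟨m₁, x₁, z₁, hm₁, hz₁, hx₁, rfl⟩ := h₁
  obtain ⟨m₂, x₂, z₂, hm₂, hz₂, hx₂, rfl⟩ := h₂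
  obtain ⟨S, hS, hSw⟩ := w.isSeparating.finSupp.exists_supp
  obtain ⟨T₁, hT₁, hTx₁, hc₁⟩ := exists_supp_card_le_one hX x₁
  obtain ⟨T₂, hT₂, hTx₂, hc₂⟩ := exists_supp_card_le_one hX x₂
  obtain ⟨g₁, hg₁, hgx₁⟩ := exists_perm_smul_eq hTx₁ hc₁ m₁
  obtain ⟨g₂, hg₂, hgx₂⟩ := exists_perm_smul_eq hTx₂ hc₂ m₂
  have hx : FinPerm.toSb 𝔸 (g₂⁻¹ * g₁) • x₁ = x₂ := by
    rw [map_mul, mul_smul, hgx₁, hx₁, ← hx₂, ← hgx₂, smul_smul, ← map_mul, inv_mul_cancel,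
      map_one, one_smul]
  have hT : ∀ a ∈ T₁, (g₂⁻¹ * g₁) • a ∈ T₂ := by
    intro a ha
    rw [← Finset.mem_coe, hT₁] at ha
    have := mem_supp_smul_of_mem (g₂⁻¹ * g₁) ha
    rw [← Finset.mem_coe, hT₂, ← hx]
    exact this
  have hfresh₂ : ∀ a ∈ S, a ∉ T₂ := by
    intro a ha hat
    rw [← Finset.mem_coe, hS] at ha
    rw [← Finset.mem_coe, hT₂] at hat
    exact (w.isSeparating.dom_iff' (x := x₂)).1 (Part.dom_iff_mem.2 ⟨_, hz₂⟩) a ha hat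
  have hfresh₁ : ∀ a ∈ T₁, a ∉ S := by
    intro a hat ha
    rw [← Finset.mem_coe, hS] at ha
    rw [← Finset.mem_coe, hT₁] at hat
    exact (w.isSeparating.dom_iff' (x := x₁)).1 (Part.dom_iff_mem.2 ⟨_, hz₁⟩) a ha hat
  -- The prescription is injective because `g₂⁻¹ * g₁` maps `T₁` into `T₂`, which is disjoint from
  -- `S`.
  obtain ⟨g, hg⟩ := exists_perm_extend (S ∪ T₁)
      (fun a => if a ∈ S then a else (g₂⁻¹ * g₁) • a) (by
    intro a ha b hb hab
    have ha := Finset.mem_union.1 (Finset.mem_coe.1 ha)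
    have hb := Finset.mem_union.1 (Finset.mem_coe.1 hb)
    by_cases h1 : a ∈ S <;> by_cases h2 : b ∈ S <;> simp only [h1, h2, if_true, if_false] at hab
    · exact hab
    · exact absurd (hab ▸ hT b (hb.resolve_left h2)) (hfresh₂ a h1)
    · exact absurd (hab ▸ hT a (ha.resolve_left h1)) (hfresh₂ b h2)
    · exact MulAction.injective _ hab)
  have hgS : ∀ a ∈ S, g • a = a := fun a ha => by
    rw [hg a (Finset.mem_union_left _ ha), if_pos ha]
  have hgT : ∀ a ∈ T₁, g • a = (g₂⁻¹ * g₁) • a := fun a ha => by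
    rw [hg a (Finset.mem_union_right _ ha), if_neg (hfresh₁ a ha)]
  have hgx : FinPerm.toSb 𝔸 g • x₁ = x₂ := (hTx₁ _ _ hgT).trans hx
  have hgz : FinPerm.toSb 𝔸 g • z₁ = z₂ := by
    have h1 := (smul_mem_pfun (X := (forgetObj X).carrier) (Y := (forgetObj Y).carrier) (x := x₁)
      (supports_iff.1 hSw g hgS)).2 hz₁
    change FinPerm.toSb 𝔸 g • z₁ ∈ w.toPFun (FinPerm.toSb 𝔸 g • x₁) at h1
    rw [hgx] at h1
    exact Part.mem_unique h1 hz₂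
  have hz : Supports (FinPerm 𝔸) (X := (forgetObj Y).carrier) ((S ∪ T₁ : Finset 𝔸) : Set 𝔸) z₁ := by
    refine supports_iff.2 fun t ht => ?_
    have h1 := (smul_mem_pfun (X := (forgetObj X).carrier) (Y := (forgetObj Y).carrier) (x := x₁)
      (supports_iff.1 hSw t fun a ha => ht a (by simp [Finset.mem_coe.1 ha]))).2 hz₁
    have h2 : FinPerm.toSb 𝔸 t • x₁ = x₁ :=
      supports_iff.1 hTx₁.toPerm t fun a ha => ht a (by simp [Finset.mem_coe.1 ha])
    change _ ∈ w.toPFun (FinPerm.toSb 𝔸 t • x₁) at h1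
    rw [h2] at h1
    exact Part.mem_unique h1 hz₁
  rw [← hgz, smul_smul]
  -- On `S` both substitutions equal `m`; on `T₁`, `m₂ • g • a = g₂ • (g₂⁻¹ * g₁) • a = g₁ • a = m₁
  -- • a`.
  refine hz.toSb _ _ fun a ha => ?_
  rw [mul_smul]
  change _ = m₂ • g • a
  rcases Finset.mem_union.1 (Finset.mem_coe.1 ha) with ha | ha
  · have ha' : a ∈ supp 𝔸 (FinPerm 𝔸) w.toPFun := by rw [← hS]; exact ha
    rw [hgS a ha, hm₁ a ha', hm₂ a ha']
  · rw [hgT a ha, ← hg₂ _ (hT a ha), mul_smul, smul_inv_smul, hg₁ a ha]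

end WandExt

end NomSets

namespace NomSets

/-- An isomorphism of nominal sets from a bijective morphism. -/
noncomputable def Nom.isoOfBijective {𝔸 M : Type u} [Monoid M] [MulAction M 𝔸] {X Y : Nom 𝔸 M}
    (f : X ⟶ Y) (hf : Function.Bijective (Nom.ap f)) : X ≅ Y where
  hom := f
  inv := Nom.mkHom (Equiv.ofBijective _ hf).symm fun m y => hf.1 <| by
    rw [Nom.ap_smul]
    change Equiv.ofBijective _ hf _ = m • Equiv.ofBijective _ hf _
    rw [Equiv.apply_symm_apply, Equiv.apply_symm_apply]
  hom_inv_id := Nom.hom_ext (Equiv.ofBijective _ hf).symm_apply_apply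
  inv_hom_id := Nom.hom_ext (Equiv.ofBijective _ hf).apply_symm_apply

/-! ### Evaluating elements of the exponent. -/

section NomExpo

variable {𝔸 : Type u} {X Y : SbNom 𝔸}

theorem NomExpo.ext_apply {f f' : NomExpo X Y} (h : ∀ m x, f.toFun (m, x) = f'.toFun (m, x)) :
    f = f' :=
  NomExpo.ext (funext fun p => h p.1 p.2)

/-- The value of an exponential at `m` depends only on the restriction of `m` to a support. -/
theorem NomExpo.toFun_congr {f : NomExpo X Y} {C : Finset 𝔸}
    (hC : Supports (Sb 𝔸) (C : Set 𝔸) f.toExpo) {m n : Sb 𝔸} (h : ∀ a ∈ C, m • a = n • a)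
    (x : X.carrier) : f.toFun (m, x) = f.toFun (n, x) := by
  have h1 := congrArg (fun q : Expo (Sb 𝔸) X.carrier Y.carrier => q.toFun (1, x)) (hC m n h)
  simpa only [Expo.smul_apply, one_mul] using h1

theorem NomExpo.toFun_smul (f : NomExpo X Y) (m : Sb 𝔸) (x : X.carrier) :
    f.toFun (m, m • x) = m • f.toFun (1, x) := by
  have h := f.equivariant m (1, x)
  rwa [Prod.smul_mk, smul_eq_mul, mul_one] at h

end NomExpo

/-! ### The isomorphism between the magic wand and the exponent. -/

section WandIso

variable {𝔸 : Type u} [Infinite 𝔸] {X X' Y Y' : SbNom 𝔸}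

/-- The extension of a separating function to an element of the exponent. -/
noncomputable def wandExt (hX : X.dim ≤ 1) (w : Wand (forgetObj X) (forgetObj Y)) :
    NomExpo X Y where
  toFun p := (WandExt.exists w p.1 p.2).choose
  equivariant n p := WandExt.unique hX (WandExt.exists w (n * p.1) (n • p.2)).choose_spec
    ((WandExt.exists w p.1 p.2).choose_spec.smul n)
  finSupp := by
    obtain ⟨S, hS, -⟩ := w.isSeparating.finSupp.exists_supp
    refine ⟨S, fun k₁ k₂ hk => Expo.ext (funext fun p => ?_)⟩
    refine WandExt.unique hX (WandExt.exists w (p.1 * k₁) p.2).choose_spec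
      ((WandExt.exists w (p.1 * k₂) p.2).choose_spec.congr fun a ha => ?_)
    rw [mul_smul, mul_smul, hk a (by rwa [hS])]

theorem wandExt_eq (hX : X.dim ≤ 1) {w : Wand (forgetObj X) (forgetObj Y)} {m : Sb 𝔸}
    {x : X.carrier} {y : Y.carrier} (h : WandExt w m x y) : (wandExt hX w).toFun (m, x) = y :=
  WandExt.unique hX (WandExt.exists w m x).choose_spec h

theorem wandExt_spec (hX : X.dim ≤ 1) (w : Wand (forgetObj X) (forgetObj Y)) (m : Sb 𝔸)
    (x : X.carrier) : WandExt w m x ((wandExt hX w).toFun (m, x)) :=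
  (WandExt.exists w m x).choose_spec

theorem wandExt_one (hX : X.dim ≤ 1) {w : Wand (forgetObj X) (forgetObj Y)}
    {x : X.carrier} {y : Y.carrier} (h : y ∈ w.toPFun x) : (wandExt hX w).toFun (1, x) = y :=
  wandExt_eq hX (.of_mem h)

theorem wandExt_smul (hX : X.dim ≤ 1) (g : FinPerm 𝔸) (w : Wand (forgetObj X) (forgetObj Y)) :
    wandExt hX (g • w) = FinPerm.toSb 𝔸 g • wandExt hX w :=
  NomExpo.ext_apply fun m x => (wandExt_eq hX (wandExt_spec hX (g • w) m x).smul_wand).symm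

/-- The extension at the identity returns the values of `w`, and a separating function is determined
by its values on fresh arguments. -/
theorem wandExt_injective (hX : X.dim ≤ 1) :
    Function.Injective (wandExt hX : Wand (forgetObj X) (forgetObj Y) → NomExpo X Y) := by
  classical
  intro w w' h
  obtain ⟨S, hS, -⟩ := w.isSeparating.finSupp.exists_supp
  obtain ⟨S', hS', -⟩ := w'.isSeparating.finSupp.exists_supp
  refine wand_ext (S ∪ S') fun x hx => ?_
  obtain ⟨y, hy⟩ := Part.dom_iff_mem.1 ((w.isSeparating.dom_iff' (x := x)).2 fun a ha =>
    hx a (Finset.mem_union_left _ (by rwa [← hS] at ha)))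
  obtain ⟨y', hy'⟩ := Part.dom_iff_mem.1 ((w'.isSeparating.dom_iff' (x := x)).2 fun a ha =>
    hx a (Finset.mem_union_right _ (by rwa [← hS'] at ha)))
  have h1 := wandExt_one hX hy
  rw [h, wandExt_one hX hy'] at h1
  rw [Part.eq_some_iff.2 hy, Part.eq_some_iff.2 hy', h1]

/-- The preimage of `f` is the separating function agreeing with `f(1, -)` on arguments fresh for a
support `C` of `f`. -/
theorem wandExt_surjective (hX : X.dim ≤ 1) :
    Function.Surjective (wandExt hX : Wand (forgetObj X) (forgetObj Y) → NomExpo X Y) := by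
  classical
  intro f
  obtain ⟨C, hC⟩ := f.finSupp
  obtain ⟨w, hw, hwf⟩ := exists_separating (X := forgetObj X) (Y := forgetObj Y)
    (fun x => Part.some (f.toFun (1, x))) C
    (supports_iff.2 fun g hg => by
      refine PFun.ext fun (x : X.carrier) (y : Y.carrier) => mem_smul_pfun.trans ?_
      refine Part.mem_some_iff.trans (Iff.trans ?_ Part.mem_some_iff.symm)
      refine Iff.trans inv_smul_eq_iff ?_
      -- For `g` fixing `C`: `g • f(1, g⁻¹ • x) = f(g, x) = f(1, x)`.
      change y = FinPerm.toSb 𝔸 g • f.toFun (1, FinPerm.toSb 𝔸 g⁻¹ • x) ↔ _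
      rw [← f.toFun_smul, smul_smul, ← map_mul, mul_inv_cancel, map_one, one_smul,
        NomExpo.toFun_congr hC (n := 1) fun a ha => (hg a ha).trans (one_smul _ a).symm]
      exact Iff.rfl)
    (fun x _ => trivial)
  obtain ⟨S, hS, -⟩ := hw.finSupp.exists_supp
  refine ⟨⟨w, hw⟩, NomExpo.ext_apply fun m x => ?_⟩
  -- Freshness for `C` gives `w(x') = f(1, x')`; agreement of `m'` with `m` on `S` and on `C` serves
  -- the extension and `f` respectively.
  obtain ⟨m', x', y', h1, h2, h3, h4⟩ := exists_fresh_value ⟨w, hw⟩ (C ∪ S) (by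
    rw [← hS]; simp) m x
  rw [wandExt_eq hX ⟨m', x', y', fun a ha => h1 a (Finset.mem_union_right _ (by
    rwa [← hS] at ha)), h3, h4, rfl⟩]
  have h5 : y' ∈ Part.some (f.toFun (1, x')) :=
    (hwf x' fun a ha => h2 a (Finset.mem_union_left _ ha)) ▸ h3
  rw [Part.mem_some_iff.1 h5, ← f.toFun_smul, h4]
  exact NomExpo.toFun_congr hC (fun a ha => h1 a (Finset.mem_union_left _ ha)) x

/-- A single pair `(m', x')`, fresh for both `w` and `v`, computes both sides: `v(x') =
k(w(h(x')))`, and `(m', h x')` is an admissible choice for `w` at `(m, h x)`. -/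
theorem wandExt_natural (hX : X.dim ≤ 1) (hX' : X'.dim ≤ 1) (h : X' ⟶ X) (k : Y ⟶ Y')
    (w : Wand (forgetObj X) (forgetObj Y)) {v : Wand (forgetObj X') (forgetObj Y')}
    (hv : v = wandMap (X := forgetObj X) (Y := forgetObj Y) ((forgetSb 𝔸).map h)
      ((forgetSb 𝔸).map k) w) :
    wandExt hX' v = Nom.ap (expMap h k) (wandExt hX w) := by
  classical
  refine NomExpo.ext_apply fun m x => ?_
  obtain ⟨S, hS, -⟩ := w.isSeparating.finSupp.exists_supp
  obtain ⟨S', hS', -⟩ := v.isSeparating.finSupp.exists_supp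
  obtain ⟨m', x', y', h1, h2, h3, rfl⟩ := exists_fresh_value v (S ∪ S') (by rw [← hS']; simp) m x
  rw [wandExt_eq hX' ⟨m', x', y', fun a ha => h1 a (Finset.mem_union_right _ (by
    rwa [← hS'] at ha)), h3, rfl, rfl⟩]
  have hsep : Separated 𝔸 w.1 (Y := (forgetObj X').carrier) x' :=
    (separated_iff w.isSeparating.finSupp ((forgetObj X').finSupp x')).2 fun a ha =>
      h2 a (Finset.mem_union_left _ (by rwa [← hS] at ha))
  have h4 : v.1 x' = (w.1 (Nom.ap (X := X') (Y := X) h x')).map (Nom.ap (X := Y) (Y := Y') k) :=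
    hv ▸ wandMap_spec (X := forgetObj X) (Y := forgetObj Y) (X' := forgetObj X')
      (Y' := forgetObj Y') ((forgetSb 𝔸).map h) ((forgetSb 𝔸).map k) w x' hsep
  obtain ⟨z, hz, rfl⟩ := (Part.mem_map_iff _).1 (h4 ▸ h3)
  have h5 : (wandExt hX w).toFun (m, Nom.ap h (m' • x')) = m' • z :=
    wandExt_eq hX ⟨m', Nom.ap h x', z, fun a ha => h1 a (Finset.mem_union_left _ (by
      rwa [← hS] at ha)), hz, (Nom.ap_smul h _ _).symm, rfl⟩
  exact ((congrArg (Nom.ap k) h5).trans (Nom.ap_smul k _ _)).symm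

end WandIso

/-- The isomorphism between the magic wand and the exponent for one-dimensional nominal
`Sb`-sets. -/
noncomputable def wandExtIso (𝔸 : Type u) [Infinite 𝔸] : wandForget 𝔸 ≅ forgetExp 𝔸 :=
  NatIso.ofComponents
    (fun X => NatIso.ofComponents
      (fun Y => Nom.isoOfBijective
        (X := wandObj (forgetObj X.unop.obj) (forgetObj Y))
        (Y := forgetObj (expObj X.unop.obj Y))
        (Nom.mkHom (wandExt X.unop.property) (wandExt_smul X.unop.property))
        ⟨wandExt_injective X.unop.property, wandExt_surjective X.unop.property⟩)
      (fun {Y Y'} k => Nom.hom_ext fun w =>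
        wandExt_natural X.unop.property X.unop.property (𝟙 _) k w rfl))
    (fun {X X'} h => by
      ext Y
      exact Nom.hom_ext fun w =>
        wandExt_natural X.unop.property X'.unop.property h.unop.hom (𝟙 _) w rfl)

/-! ### Name abstraction as the exponent by the atoms. -/

section Abstraction

variable {𝔸 : Type u}

open Classical in
/-- The substitution `m` with its value at `a` changed to `c`. -/
noncomputable def Sb.update (m : Sb 𝔸) (a c : 𝔸) : Sb 𝔸 :=
  ⟨Function.update (fun b => m • b) a c, (Set.Finite.insert a m.2).subset fun b hb => by
    by_contra h
    rw [Set.mem_insert_iff, not_or] at h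
    refine h.2 fun hm => hb ?_
    exact (Function.update_of_ne h.1 _ _).trans hm⟩

theorem Sb.update_smul_self (m : Sb 𝔸) (a c : 𝔸) : Sb.update m a c • a = c := by
  classical
  exact Function.update_self a c (fun b => m • b)

theorem Sb.update_smul_of_ne (m : Sb 𝔸) {a b : 𝔸} (c : 𝔸) (h : b ≠ a) :
    Sb.update m a c • b = m • b := by
  classical
  exact Function.update_of_ne h c (fun b => m • b)

theorem Sb.ext_smul {m n : Sb 𝔸} (h : ∀ a : 𝔸, m • a = n • a) : m = n :=
  Subtype.ext (funext h)

theorem Sb.mul_update (n m : Sb 𝔸) (a c : 𝔸) :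
    Sb.update (n * m) a (n • c) = n * Sb.update m a c := by
  refine Sb.ext_smul fun b => ?_
  rw [mul_smul]
  by_cases h : b = a
  · rw [h, Sb.update_smul_self, Sb.update_smul_self]
  · rw [Sb.update_smul_of_ne _ _ h, Sb.update_smul_of_ne _ _ h, mul_smul]

theorem Sb.update_mul_toSb (m : Sb 𝔸) (g : FinPerm 𝔸) (a c : 𝔸) :
    Sb.update m (g • a) c * FinPerm.toSb 𝔸 g = Sb.update (m * FinPerm.toSb 𝔸 g) a c := by
  refine Sb.ext_smul fun b => ?_
  rw [mul_smul]
  change Sb.update m (g • a) c • g • b = _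
  by_cases h : b = a
  · rw [h, Sb.update_smul_self, Sb.update_smul_self]
  · rw [Sb.update_smul_of_ne _ _ h, Sb.update_smul_of_ne _ _ fun e => h (MulAction.injective g e),
      mul_smul]
    rfl

theorem Sb.update_one_self (a : 𝔸) : Sb.update 1 a a = 1 := by
  refine Sb.ext_smul fun b => ?_
  by_cases h : b = a
  · rw [h, Sb.update_smul_self, one_smul]
  · rw [Sb.update_smul_of_ne _ _ h]

variable {Y Z : SbNom 𝔸}

/-- The equivariant map `(m, c) ↦ m[a ↦ c] • y`. -/
noncomputable def absExpo (a : 𝔸) (y : Y.carrier) :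
    Expo (Sb 𝔸) (atoms 𝔸 (Sb 𝔸)).carrier Y.carrier where
  toFun p := Sb.update p.1 a p.2 • y
  equivariant n p := by
    rw [← mul_smul]
    exact congrArg (· • y) (Sb.mul_update n p.1 a p.2)

-- The value at `(m, c)` after acting by `k` is `(m * k)[a ↦ c] • y`, where the value of `k` at `a`
-- is overwritten. Hence `a` can be dropped from the support.
open Classical in
theorem supports_absExpo {C : Finset 𝔸} {y : Y.carrier} (hC : Supports (Sb 𝔸) (C : Set 𝔸) y)
    (a : 𝔸) : Supports (Sb 𝔸) ((C.erase a : Finset 𝔸) : Set 𝔸) (absExpo a y) := by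
  refine fun k₁ k₂ hk => Expo.ext (funext fun p => hC _ _ fun b hb => ?_)
  change Sb.update (p.1 * k₁) a (show 𝔸 from p.2) • b =
    Sb.update (p.1 * k₂) a (show 𝔸 from p.2) • b
  by_cases h : b = a
  · rw [h, Sb.update_smul_self, Sb.update_smul_self]
  · rw [Sb.update_smul_of_ne _ _ h, Sb.update_smul_of_ne _ _ h, mul_smul, mul_smul,
      hk b (Finset.mem_coe.2 (Finset.mem_erase.2 ⟨h, hb⟩))]

/-- The element `(m, c) ↦ m[a ↦ c] • y` of the exponent. -/
noncomputable def absExp (a : 𝔸) (y : Y.carrier) : NomExpo (atoms 𝔸 (Sb 𝔸)) Y where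
  toExpo := absExpo a y
  finSupp := by
    classical
    obtain ⟨C, hC⟩ := Y.finSupp y
    exact ⟨C.erase a, supports_absExpo hC a⟩

theorem absExp_apply (a : 𝔸) (y : Y.carrier) (m : Sb 𝔸) (c : 𝔸) :
    (absExp a y).toFun (m, c) = Sb.update m a c • y := rfl

theorem absExp_one (a : 𝔸) (y : Y.carrier) : (absExp a y).toFun (1, a) = y := by
  rw [absExp_apply, Sb.update_one_self, one_smul]

theorem absExp_smul (g : FinPerm 𝔸) (a : 𝔸) (y : Y.carrier) :
    absExp (g • a) (FinPerm.toSb 𝔸 g • y) = FinPerm.toSb 𝔸 g • absExp a y :=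
  NomExpo.ext_apply fun m (c : 𝔸) => by
    change Sb.update m (g • a) c • FinPerm.toSb 𝔸 g • y = Sb.update (m * FinPerm.toSb 𝔸 g) a c • y
    rw [smul_smul, Sb.update_mul_toSb]

variable [Infinite 𝔸]

/-- Both `m[b ↦ c]` after `(a b)` and `m[a ↦ c]` send `a` to `c`, and they agree on all other atoms
of the support of `y`, as `b` is not among them. -/
theorem absExp_rename {a b : 𝔸} {y : Y.carrier}
    (hby : b ∉ supp 𝔸 (FinPerm 𝔸) (X := (forgetObj Y).carrier) y) :
    absExp b (FinPerm.toSb 𝔸 (FinPerm.swap a b) • y) = absExp a y := by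
  obtain ⟨C, hC, hCy⟩ := ((forgetObj Y).finSupp y).exists_supp
  refine NomExpo.ext_apply fun m (c : 𝔸) => ?_
  change Sb.update m b c • FinPerm.toSb 𝔸 (FinPerm.swap a b) • y = Sb.update m a c • y
  rw [smul_smul]
  refine hCy.toSb _ _ fun d hd => ?_
  have hdb : d ≠ b := fun h => hby (by rwa [← hC, ← h])
  rw [mul_smul]
  change Sb.update m b c • FinPerm.swap a b • d = _
  by_cases h : d = a
  · rw [h, FinPerm.swap_smul_left, Sb.update_smul_self, Sb.update_smul_self]
  · rw [FinPerm.swap_smul_of_ne h hdb, Sb.update_smul_of_ne _ _ h, Sb.update_smul_of_ne _ _ hdb]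

/-- Renaming both bound atoms to a common fresh `b` reduces the claim to comparing `(a b) • y` with
`(a' b) • y'`, which evaluation at `(1, b)` recovers. One direction makes `absExt` well defined, the
other makes it injective. -/
theorem absExp_eq_iff {a a' : 𝔸} {y y' : Y.carrier} :
    absExp a y = absExp a' y' ↔ AlphaEquiv (forgetObj Y) (a, y) (a', y') := by
  constructor
  · intro h
    obtain ⟨b, hb⟩ := exists_fresh_atom (forgetObj Y) [(a, y), (a', y')]
    obtain ⟨h1, h2⟩ := hb (a, y) (by simp)
    obtain ⟨h3, h4⟩ := hb (a', y') (by simp)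
    refine ⟨b, h1, h2, h3, h4, ?_⟩
    rw [← absExp_rename h2, ← absExp_rename h4] at h
    have h5 := congrArg (fun f : NomExpo (atoms 𝔸 (Sb 𝔸)) Y => f.toFun (1, b)) h
    rwa [absExp_one, absExp_one] at h5
  · rintro ⟨b, -, h2, -, h4, h⟩
    rw [← absExp_rename h2, ← absExp_rename h4]
    exact congrArg (absExp b) h

/-- The map `[a]y ↦ ((m, c) ↦ m[a ↦ c] • y)` from name abstractions to the exponent. -/
noncomputable def absExt (q : (absObj (forgetObj Y)).carrier) : NomExpo (atoms 𝔸 (Sb 𝔸)) Y :=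
  Quotient.lift (fun p : 𝔸 × Y.carrier => absExp p.1 p.2) (fun _ _ h => absExp_eq_iff.2 h) q

theorem absExt_bijective :
    Function.Bijective (absExt : (absObj (forgetObj Y)).carrier → NomExpo (atoms 𝔸 (Sb 𝔸)) Y) := by
  constructor
  · rintro ⟨p⟩ ⟨q⟩ h
    exact Quotient.sound (absExp_eq_iff.1 h)
  · intro f
    obtain ⟨C, hC⟩ := f.finSupp
    -- For `a` outside `C`, `m[a ↦ c]` agrees with `m` on `C`, so `m[a ↦ c] • f(1, a) = f(m[a ↦ c],
    -- c) = f(m, c)`.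
    obtain ⟨a, ha⟩ := Infinite.exists_notMem_finset C
    refine ⟨absMk (Y := forgetObj Y) a (f.toFun (1, a)), NomExpo.ext_apply fun m c => ?_⟩
    have h1 := f.toFun_smul (Sb.update m a c) a
    have h2 : Sb.update m a c • (show (atoms 𝔸 (Sb 𝔸)).carrier from a) = c :=
      Sb.update_smul_self m a c
    refine h1.symm.trans ((congrArg (fun d => f.toFun (Sb.update m a c, d)) h2).trans ?_)
    exact NomExpo.toFun_congr hC
      (fun b hb => Sb.update_smul_of_ne m c fun h : b = a => ha (h ▸ hb)) c

theorem absExt_smul (g : FinPerm 𝔸) (q : (absObj (forgetObj Y)).carrier) :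
    absExt (g • q) = FinPerm.toSb 𝔸 g • absExt q := by
  obtain ⟨a, y⟩ := q
  exact absExp_smul g a y

end Abstraction

/-- The isomorphism between name abstractions and the exponent of the atoms. -/
noncomputable def absExtIso (𝔸 : Type u) [Infinite 𝔸] :
    forgetSb 𝔸 ⋙ absFunctor 𝔸 ≅ (forgetExp 𝔸).obj (Opposite.op (atoms₁ 𝔸)) :=
  NatIso.ofComponents
    (fun Y => Nom.isoOfBijective (X := absObj (forgetObj Y))
      (Y := forgetObj (expObj (atoms 𝔸 (Sb 𝔸)) Y)) (Nom.mkHom absExt absExt_smul) absExt_bijective)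
    (fun {Y Z} k => Nom.hom_ext fun q => by
      obtain ⟨a, y⟩ := q
      exact NomExpo.ext_apply fun m c => (Nom.ap_smul k _ y).symm)

/-- The point is that `w` is defined at `a`. Its extension has a support without `a`, and so does
`w`, because the extension map is injective and equivariant. The value is then read off at `(1, a)`.
-/
theorem wandVal_of_wandExt_eq {𝔸 : Type u} [Infinite 𝔸] {Y : SbNom 𝔸} {a : 𝔸} {y : Y.carrier}
    {w : Wand (forgetObj (atoms 𝔸 (Sb 𝔸))) (forgetObj Y)}
    (h : wandExt dim_atoms_le w = absExp a y) : y ∈ w.toPFun a := by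
  classical
  obtain ⟨C, hC⟩ := Y.finSupp y
  have hw : Supports (FinPerm 𝔸) ((C.erase a : Finset 𝔸) : Set 𝔸) w.toPFun := by
    intro g₁ g₂ hg
    refine congrArg Wand.toPFun (wandExt_injective dim_atoms_le (a₁ := g₁ • w) (a₂ := g₂ • w) ?_)
    rw [wandExt_smul, wandExt_smul, h]
    exact NomExpo.ext (congrArg Expo.toFun (supports_absExpo hC a _ _ hg))
  have hsep : Separated 𝔸 w.toPFun (Y := (forgetObj (atoms 𝔸 (Sb 𝔸))).carrier) a :=
    ⟨C.erase a, {a}, by simp, hw, fun _ _ hg => hg a (by simp)⟩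
  obtain ⟨z, hz⟩ := Part.dom_iff_mem.1 ((w.isSeparating.dom_iff _).2 hsep)
  have h1 := wandExt_one dim_atoms_le hz
  rw [h, absExp_one] at h1
  rwa [h1]

end NomSets

theorem corollary3p15 (𝔸 : Type u) [Countable 𝔸] [Infinite 𝔸] :
    ∃ e : NomSets.wandForget 𝔸 ≅ NomSets.forgetExp 𝔸,
      (∀ (X : NomSets.SbNom₁ 𝔸) (Y : NomSets.SbNom 𝔸)
        (w : (((NomSets.wandForget 𝔸).obj (Opposite.op X)).obj Y).carrier)
        (x : X.obj.carrier) (y : Y.carrier), NomSets.WandVal w x y →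
          NomSets.expVal (NomSets.Nom.ap ((e.hom.app (Opposite.op X)).app Y) w) 1 x = y) ∧
      ∃ θ : NomSets.forgetSb 𝔸 ⋙ NomSets.absFunctor 𝔸 ≅
          (NomSets.forgetExp 𝔸).obj (Opposite.op (NomSets.atoms₁ 𝔸)),
        ∀ (Y : NomSets.SbNom 𝔸) (a : 𝔸) (y : Y.carrier),
          NomSets.WandVal (X := NomSets.atoms₁ 𝔸)
            (NomSets.Nom.ap ((e.inv.app (Opposite.op (NomSets.atoms₁ 𝔸))).app Y)
              (NomSets.Nom.ap (θ.hom.app Y)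
                (NomSets.absMk (Y := NomSets.forgetObj Y) a y))) a y := by
  refine ⟨NomSets.wandExtIso 𝔸, fun X Y w x y h => NomSets.wandExt_one X.property h,
    NomSets.absExtIso 𝔸, fun Y a y => NomSets.wandVal_of_wandExt_eq ?_⟩
  -- The remaining goal is that extending the preimage of `absExp a y` gives `absExp a y` back.
  exact congrArg (fun k => NomSets.Nom.ap k (NomSets.absExp a y))
    (((NomSets.wandExtIso 𝔸).app (Opposite.op (NomSets.atoms₁ 𝔸))).app Y).inv_hom_id
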